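/- Let $1\le q\le n$, let $D\subset\mathbb R^n$ be a domain (nonempty connected open set), let $E=D\times\mathbb R^r$ be the trivial bundle with frame $e_1,\dots,e_r$, and let $g=(g_{\tau\xi}):D\to \mathrm{Sym}^+_r(\mathbb R)$ be a $C^2$ Riemannian metric on $E$ (with values in the positive definite symmetric matrices). For $E$-valued forms $\alpha=\sum_{\tau}\sum_{|I|=q}\alpha_{I,\tau}\,dx_I\otimes e_\tau$ and $\beta$ (with $I$ increasing) put $\langle\alpha,\beta\rangle_g=\sum_{\tau,\xi}\sum_I\alpha_{I,\tau}\beta_{I,\xi}g_{\tau\xi}$. The curvature operator of $g$ on $E$-valued $q$-forms is $$\Theta_E=-\sum_{i,j=1}^n \frac{\partial}{\partial x_i}\Big(g^{-1}\frac{\partial g}{\partial x_j}\Big)\,dx_i\wedge \frac{\partial}{\partial x_j}\lrcorner ,$$ and $(E,g)$ is called Nakano $q$-semipositive if $\langle\Theta_E\alpha,\alpha\rangle_g\ge 0$ at every $x\in D$ for every $\alpha\in\wedge^q(\mathbb R^n)^*\otimes\mathbb R^r$. For a smooth function $\psi:\mathbb R^n\to\mathbb R$ with everywhere positive definite Hessian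 matrix $(\psi_{ij})$ (a strictly convex weight), let $\mathrm{Hess}_\psi=\sum_{i,j}\psi_{ij}\,dx_i\wedge\frac{\partial}{\partial x_j}\lrcorner$, acting on $q$-forms; it is invertible. Say that the $L^2$ existence property holds for $\psi$ if for every smooth $d$-closed $E$-valued $q$-form $f$ with compact support in $D$ for which the right-hand side below is finite, there is an $E$-valued $(q-1)$-form $u$ on $D$, in $L^2$ with respect to the metric $g\,e^{-\psi}$, with $du=f$ in the sense of distributions and $$\int_D\langle u,u\rangle_g\,e^{-\psi}\,d\lambda\le\int_D\langle \mathrm{Hess}_\psi^{-1}f,f\rangle_g\,e^{-\psi}\,d\lambda .$$ If the $L^2$ existence property holds for every strictly convex weight $\psi$ on $\mathbb R^n$, then $(E,g)$ is Nakano $q$-semipositive. It is already enough that it holds for all weights of the form $\psi(x)=a|x-x_0|^2-b$ with $a,b>0$ and $x_0\in\mathbb R^n$. -/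

import Mathlib

namespace FlatBundle

open MeasureTheory
open scoped ContDiff

/-- The Euclidean space `ℝⁿ` with coordinates `x_1, …, x_n`. -/
abbrev Rn (n : ℕ) : Type := EuclideanSpace ℝ (Fin n)

/-- `⋀^q (ℝⁿ)^* ⊗ ℝ^r`: the fibre of the bundle of `E`-valued `q`-forms, `E = D × ℝ^r`.
An `E`-valued `q`-form is a function `Rn n → Form n r q`, regarded on `D`. -/
abbrev Form (n r q : ℕ) : Type := Rn n [⋀^Fin q]→L[ℝ] (Fin r → ℝ)

variable {n r q p : ℕ}

/-- The coordinate vector `∂/∂x_i`. -/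
noncomputable def frame (i : Fin n) : Rn n := EuclideanSpace.single i 1

/-- The coordinate covector `dx_i`. -/
noncomputable def coframe (i : Fin n) : Rn n →L[ℝ] ℝ := EuclideanSpace.proj i

/-- The partial derivative `∂φ/∂x_i` of a real function. -/
noncomputable def partialD (i : Fin n) (φ : Rn n → ℝ) (x : Rn n) : ℝ :=
  fderiv ℝ φ x (frame i)

/-- The entrywise partial derivative `∂A/∂x_i` of a matrix-valued function. -/
noncomputable def partialDMat (i : Fin n) (A : Rn n → Matrix (Fin r) (Fin r) ℝ) (x : Rn n) :
    Matrix (Fin r) (Fin r) ℝ :=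
  Matrix.of fun τ ξ => partialD i (fun y => A y τ ξ) x

/-- The exterior product `ℓ ∧ β` of a covector with a `p`-form:
`(ℓ ∧ β)(v_0, …, v_p) = ∑ k, (-1)^k ℓ(v_k) β(v_0, …, v̂_k, …, v_p)`. -/
noncomputable def wedge (ℓ : Rn n →L[ℝ] ℝ) (β : Form n r p) : Form n r (p + 1) :=
  ContinuousAlternatingMap.alternatizeUncurryFin (ℓ.smulRight β)

/-- The interior product `v ⌟ α`. -/
noncomputable def contract (v : Rn n) (α : Form n r (p + 1)) : Form n r p :=
  α.curryLeft v

/-- A matrix acting on the `ℝ^r`-factor of a form. -/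
noncomputable def actFibre (A : Matrix (Fin r) (Fin r) ℝ) (α : Form n r q) : Form n r q :=
  (LinearMap.toContinuousLinearMap A.mulVecLin).compContinuousAlternatingMap α

/-- The operator `∑ i j, A_{ij} dx_i ∧ (∂/∂x_j ⌟ ·)` on `(p+1)`-forms, where the matrices
`A_{ij}` act on the `ℝ^r`-factor. -/
noncomputable def wedgeContractOp (A : Fin n → Fin n → Matrix (Fin r) (Fin r) ℝ) :
    Form n r (p + 1) →ₗ[ℝ] Form n r (p + 1) where
  toFun α := ∑ i, ∑ j, wedge (coframe i) (actFibre (A i j) (contract (frame j) α))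
  map_add' α β := by
    simp only [← Finset.sum_add_distrib]
    refine Finset.sum_congr rfl fun i _ => Finset.sum_congr rfl fun j _ => ?_
    ext v k
    simp [wedge, actFibre, contract, ContinuousAlternatingMap.alternatizeUncurryFin_apply,
      Finset.sum_add_distrib]
  map_smul' c α := by
    simp only [Finset.smul_sum, RingHom.id_apply]
    refine Finset.sum_congr rfl fun i _ => Finset.sum_congr rfl fun j _ => ?_
    ext v k
    simp [wedge, actFibre, contract, ContinuousAlternatingMap.alternatizeUncurryFin_apply,
      Finset.mul_sum, mul_left_comm]

/-- The curvature operator of the metric `g` at `x`, on `(p+1)`-forms: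
`Θ_E = -∑ i j, ∂/∂x_i (g⁻¹ ∂g/∂x_j) dx_i ∧ (∂/∂x_j ⌟ ·)`. -/
noncomputable def curvatureOp (g : Rn n → Matrix (Fin r) (Fin r) ℝ) (x : Rn n) :
    Form n r (p + 1) →ₗ[ℝ] Form n r (p + 1) :=
  -wedgeContractOp fun i j => partialDMat i (fun y => (g y)⁻¹ * partialDMat j g y) x

/-- The Hessian matrix `(∂²ψ/∂x_i∂x_j)`. -/
noncomputable def hessMatrix (ψ : Rn n → ℝ) (x : Rn n) : Matrix (Fin n) (Fin n) ℝ :=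
  Matrix.of fun i j => partialD i (partialD j ψ) x

/-- The operator `Hess_ψ = ∑ i j, ψ_{ij} dx_i ∧ (∂/∂x_j ⌟ ·)` on `(p+1)`-forms at `x`. -/
noncomputable def hessOp (ψ : Rn n → ℝ) (x : Rn n) : Form n r (p + 1) →ₗ[ℝ] Form n r (p + 1) :=
  wedgeContractOp fun i j => hessMatrix ψ x i j • (1 : Matrix (Fin r) (Fin r) ℝ)

/-- The inverse operator `Hess_ψ⁻¹` on `(p+1)`-forms at `x`. (For positive definite Hessian
matrix the operator is invertible.) -/
noncomputable def hessOpInv (ψ : Rn n → ℝ) (x : Rn n) :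
    Form n r (p + 1) →ₗ[ℝ] Form n r (p + 1) :=
  Ring.inverse (hessOp ψ x : Module.End ℝ (Form n r (p + 1)))

/-- The pointwise inner product `⟨α, β⟩_g = ∑_{I, τ, ξ} α_{I,τ} β_{I,ξ} g_{τξ}`, where
`I = (i_1 < … < i_q)` runs over the increasing multi-indices and
`α_{I,τ} = α(∂/∂x_{i_1}, …, ∂/∂x_{i_q})_τ`. -/
noncomputable def formInner (G : Matrix (Fin r) (Fin r) ℝ) (α β : Form n r q) : ℝ :=
  ∑ τ, ∑ ξ, ∑ I : Fin q ↪o Fin n,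
    α (fun k => frame (I k)) τ * β (fun k => frame (I k)) ξ * G τ ξ

/-- `g` is a `C²` Riemannian metric on the trivial bundle `D × ℝ^r`. -/
structure IsC2Metric (D : Set (Rn n)) (g : Rn n → Matrix (Fin r) (Fin r) ℝ) : Prop where
  posDef : ∀ x ∈ D, (g x).PosDef
  contDiffOn : ∀ τ ξ, ContDiffOn ℝ 2 (fun x => g x τ ξ) D

/-- `(E, g)` is Nakano `(p+1)`-semipositive over `D`. -/
def NakanoSemipositive (p : ℕ) (D : Set (Rn n)) (g : Rn n → Matrix (Fin r) (Fin r) ℝ) : Prop :=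
  ∀ x ∈ D, ∀ α : Form n r (p + 1), 0 ≤ formInner (g x) (curvatureOp g x α) α

/-- `ψ` is a smooth strictly convex function on `ℝⁿ`: its Hessian is positive definite. -/
structure IsStrictlyConvexWeight (ψ : Rn n → ℝ) : Prop where
  contDiff : ContDiff ℝ ∞ ψ
  hess_posDef : ∀ x, (hessMatrix ψ x).PosDef

/-- `f` is a smooth `E`-valued `q`-form with compact support in `D` (extended by zero). -/
structure IsCompactlySupportedForm (D : Set (Rn n)) (f : Rn n → Form n r q) : Prop where
  contDiff : ContDiff ℝ ∞ f
  hasCompactSupport : HasCompactSupport f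
  tsupport_subset : tsupport f ⊆ D

/-- `du = f` on `D` in the sense of distributions:
`∫_D φ f = -∫_D dφ ∧ u` for all test functions `φ ∈ C_c^∞(D)`. -/
def IsWeakExtDeriv (D : Set (Rn n)) (u : Rn n → Form n r p) (f : Rn n → Form n r (p + 1)) :
    Prop :=
  LocallyIntegrableOn u D ∧ LocallyIntegrableOn f D ∧
    ∀ φ : Rn n → ℝ, ContDiff ℝ ∞ φ → HasCompactSupport φ → tsupport φ ⊆ D →
      ∫ x in D, φ x • f x = -∫ x in D, wedge (fderiv ℝ φ x) (u x)

/-- The `L²` existence property for the weight `ψ`: for every smooth `d`-closed `E`-valued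
`(p+1)`-form `f` with compact support in `D` for which the right-hand side is finite, there is
an `L²` `p`-form `u` (with respect to the metric `g e^{-ψ}`) such that `du = f` weakly and
`∫_D ⟨u, u⟩_g e^{-ψ} ≤ ∫_D ⟨Hess_ψ⁻¹ f, f⟩_g e^{-ψ}`. -/
def L2Solvable (p : ℕ) (D : Set (Rn n)) (g : Rn n → Matrix (Fin r) (Fin r) ℝ)
    (ψ : Rn n → ℝ) : Prop :=
  ∀ f : Rn n → Form n r (p + 1), IsCompactlySupportedForm D f → (∀ x ∈ D, extDeriv f x = 0) →
    IntegrableOn (fun x => formInner (g x) (hessOpInv ψ x (f x)) (f x) * Real.exp (-ψ x)) D →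
    ∃ u : Rn n → Form n r p,
      IsWeakExtDeriv D u f ∧
      IntegrableOn (fun x => formInner (g x) (u x) (u x) * Real.exp (-ψ x)) D ∧
      ∫ x in D, formInner (g x) (u x) (u x) * Real.exp (-ψ x) ≤
        ∫ x in D, formInner (g x) (hessOpInv ψ x (f x)) (f x) * Real.exp (-ψ x)

end FlatBundle

/-!
Only the weights `ψ = a |x - x₀|² - 1` are needed. For them `Hess_ψ` is multiplication by `2 a q`
on `q`-forms, so solving `du = f` with the `L²` estimate and pairing the equation with `f` itself
gives, by the Cauchy-Schwarz inequality, `2 a q ‖f‖² ≤ ‖d^* f‖²`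
(`mul_integral_le_integral_metricDiv`). Here `d^*` is the adjoint of `d` for the metric
`h = g e^{-ψ}`, and the norms are those of `h`. As `h` is only `C²`, the pairing needs test
functions which are not smooth; `integral_mul_eq_of_contDiff_one` admits them.

On the other hand, integrating by parts twice (`integral_divIntegrand`, `integral_metricDiv`) gives
the Bochner formula
`‖d^* f‖² = ∫ ⟨Θ_E f, f⟩_g e^{-ψ} + 2 a q ‖f‖² + ∫ ∑ i j, ⟨∂_j f_i, ∂_i f_j⟩_g e^{-ψ}`,
where `f_i = ∂/∂x_i ⌟ f` and the derivatives are the flat ones; the middle term is the curvature of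
the weight (`bochnerIntegrand_exp_smul`). Hence the two other integrals have a nonnegative sum
for every closed `f` with compact support and every `a` (`integral_bochnerIntegrand_nonneg`).

Given a point `x₀` and `α` in the fibre, there is a closed form `f` with compact support which
equals `α` near `x₀` (`exists_closed_form`), so that its derivatives vanish there. For `a → ∞` the
weights concentrate at `x₀` (`nonneg_of_integral_gaussian_nonneg`), and
`⟨Θ_E α, α⟩_g ≥ 0` at `x₀` remains.

Sums over increasing multi-indices are replaced by sums over all multi-indices
(`formInner_eq_sum`), and the contractions `f_i` are treated through their coefficients
`f_{iJ}`, which for a fixed `J` are `n` functions with values in `ℝ^r`.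
-/

namespace FlatBundle

open MeasureTheory Matrix Metric Filter Topology
open scoped ContDiff Convolution

variable {n r q p : ℕ}

/-! ### Forms in coordinates -/

/-- The coefficient `α_I = α(∂/∂x_{I 0}, …, ∂/∂x_{I (q-1)}) ∈ ℝ^r` of a form, for an arbitrary
(not necessarily increasing) multi-index `I`. -/
noncomputable def coeff (α : Form n r q) (I : Fin q → Fin n) : Fin r → ℝ :=
  α fun k => frame (I k)

lemma coeff_smul (c : ℝ) (α : Form n r q) (I : Fin q → Fin n) :
    coeff (c • α) I = c • coeff α I := rfl

lemma coeff_sum {ι : Type*} (s : Finset ι) (α : ι → Form n r q) (I : Fin q → Fin n) :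
    coeff (∑ i ∈ s, α i) I = ∑ i ∈ s, coeff (α i) I := by
  simp [coeff]

lemma coeff_zero (I : Fin q → Fin n) : coeff (0 : Form n r q) I = 0 := rfl

lemma coeff_actFibre (A : Matrix (Fin r) (Fin r) ℝ) (α : Form n r q) (I : Fin q → Fin n) :
    coeff (actFibre A α) I = A *ᵥ coeff α I := rfl

lemma coeff_contract (i : Fin n) (α : Form n r (p + 1)) (J : Fin p → Fin n) :
    coeff (contract (frame i) α) J = coeff α (Fin.cons i J) := by
  unfold coeff contract
  rw [ContinuousAlternatingMap.curryLeft_apply_apply]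
  congr 1
  ext k : 1
  refine Fin.cases ?_ (fun k => ?_) k <;> simp

lemma coeff_wedge (ℓ : Rn n →L[ℝ] ℝ) (β : Form n r p) (I : Fin (p + 1) → Fin n) :
    coeff (wedge ℓ β) I =
      ∑ k : Fin (p + 1), (-1 : ℝ) ^ (k : ℕ) • ℓ (frame (I k)) • coeff β (k.removeNth I) := by
  unfold coeff wedge
  rw [ContinuousAlternatingMap.alternatizeUncurryFin_apply]
  refine Finset.sum_congr rfl fun k _ => ?_
  rw [← Int.cast_smul_eq_zsmul ℝ]
  simp
  rfl

lemma coeff_insertNth (α : Form n r (p + 1)) (k : Fin (p + 1)) (i : Fin n) (J : Fin p → Fin n) :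
    coeff α (k.insertNth i J) = (-1 : ℝ) ^ (k : ℕ) • coeff α (Fin.cons i J) := by
  have h := α.toAlternatingMap.map_insertNth k (frame i) (fun j => frame (n := n) (J j))
  have e1 : (k.insertNth (frame i) fun j => frame (n := n) (J j) : Fin (p + 1) → Rn n) =
      fun l => frame ((k.insertNth i J : Fin (p + 1) → Fin n) l) := by
    ext l : 1
    refine Fin.succAboveCases k ?_ (fun l => ?_) l <;> simp
  have e2 : (Matrix.vecCons (frame i) fun j => frame (n := n) (J j) : Fin (p + 1) → Rn n) =
      fun l => frame ((Fin.cons i J : Fin (p + 1) → Fin n) l) := by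
    ext l : 1
    refine Fin.cases ?_ (fun l => ?_) l <;> simp
  rw [e1, e2, ← Int.cast_smul_eq_zsmul ℝ] at h
  simpa [coeff] using h

lemma coeff_comp_perm (α : Form n r q) (I : Fin q → Fin n) (σ : Equiv.Perm (Fin q)) :
    coeff α (I ∘ σ) = ((Equiv.Perm.sign σ : ℤ) : ℝ) • coeff α I := by
  have h := α.toAlternatingMap.map_perm (fun k => frame (n := n) (I k)) σ
  rw [Units.smul_def, ← Int.cast_smul_eq_zsmul ℝ] at h
  exact h

lemma coeff_eq_zero (α : Form n r q) (I : Fin q → Fin n) (hI : ¬ Function.Injective I) :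
    coeff α I = 0 := by
  simp only [Function.Injective, not_forall] at hI
  obtain ⟨a, b, hab, hne⟩ := hI
  exact α.map_eq_zero_of_eq _ (i := a) (j := b) (by simp [hab]) hne

/-- A permutation-invariant function of multi-indices which vanishes on multi-indices with a
repetition has `q!` times as large a sum over all multi-indices as over the increasing ones. -/
lemma sum_multiIndex {F : (Fin q → Fin n) → ℝ} (h0 : ∀ I, ¬ Function.Injective I → F I = 0)
    (hσ : ∀ (I : Fin q → Fin n) (σ : Equiv.Perm (Fin q)), F (I ∘ σ) = F I) :
    ∑ I, F I = (q.factorial : ℝ) * ∑ I : Fin q ↪o Fin n, F I := by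
  classical
  let e : (Fin q ↪o Fin n) × Equiv.Perm (Fin q) → {I : Fin q → Fin n // Function.Injective I} :=
    fun x => ⟨x.1 ∘ x.2, x.1.injective.comp x.2.injective⟩
  have he : Function.Bijective e := by
    constructor
    · rintro ⟨I, σ⟩ ⟨I', σ'⟩ h
      have h1 : (I : Fin q → Fin n) ∘ σ = I' ∘ σ' := congrArg Subtype.val h
      have h2 : I = I' := by
        rw [← OrderEmbedding.range_inj]
        have := congrArg Set.range h1
        simpa [EquivLike.range_comp] using this
      subst h2
      congr 1
      ext k : 1
      exact I.injective (congrFun h1 k)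
    · rintro ⟨I, hI⟩
      have hm : StrictMono (I ∘ Tuple.sort I) :=
        (Tuple.monotone_sort I).strictMono_of_injective (hI.comp (Tuple.sort I).injective)
      refine ⟨⟨OrderEmbedding.ofStrictMono _ hm, (Tuple.sort I)⁻¹⟩, ?_⟩
      ext k : 2
      simp [e]
  have h1 : ∑ I, F I = ∑ I : {I : Fin q → Fin n // Function.Injective I}, F I := by
    rw [← Finset.sum_subtype (Finset.univ.filter Function.Injective) (by simp) F,
      Finset.sum_filter]
    refine Finset.sum_congr rfl fun I _ => ?_
    split_ifs with h
    · rfl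
    · exact h0 I h
  rw [h1, ← Function.Bijective.sum_comp he (fun I => F I.1), Fintype.sum_prod_type, Finset.mul_sum]
  refine Finset.sum_congr rfl fun I _ => ?_
  simp [e, hσ, Fintype.card_perm]

/-- The inner product of forms as a normalized sum over all multi-indices. In this form, the
adjointness of exterior and interior multiplication is a reindexing of sums. -/
lemma formInner_eq_sum (G : Matrix (Fin r) (Fin r) ℝ) (α β : Form n r q) :
    formInner G α β =
      (q.factorial : ℝ)⁻¹ * ∑ I : Fin q → Fin n, coeff α I ⬝ᵥ G *ᵥ coeff β I := by
  rw [sum_multiIndex]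
  · rw [inv_mul_cancel_left₀ (by positivity)]
    unfold formInner
    simp only [dotProduct, mulVec, Finset.mul_sum]
    rw [Finset.sum_congr rfl fun τ _ => Finset.sum_comm, Finset.sum_comm]
    refine Finset.sum_congr rfl fun I _ => Finset.sum_congr rfl fun τ _ =>
      Finset.sum_congr rfl fun ξ _ => ?_
    simp only [coeff]
    ring
  · intro I hI
    simp [coeff_eq_zero α I hI]
  · intro I σ
    rw [coeff_comp_perm, coeff_comp_perm, mulVec_smul, smul_dotProduct, dotProduct_smul,
      smul_smul, ← Int.cast_mul, ← Units.val_mul]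
    simp

lemma frame_apply (i j : Fin n) : frame i j = if j = i then (1 : ℝ) else 0 := by
  simp [frame]

lemma coframe_frame (i j : Fin n) : coframe i (frame j) = if i = j then (1 : ℝ) else 0 := by
  simp [coframe, frame_apply]

/-- Exterior multiplication by `dx_i` is adjoint to contraction with `∂/∂x_i`. -/
lemma sum_coeff_wedge_dotProduct (i : Fin n) (β : Form n r p) (α : Form n r (p + 1)) :
    ∑ I, coeff (wedge (coframe i) β) I ⬝ᵥ coeff α I =
      ((p : ℝ) + 1) * ∑ J, coeff β J ⬝ᵥ coeff α (Fin.cons i J) := by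
  have key : ∀ k : Fin (p + 1), ∑ I : Fin (p + 1) → Fin n,
      ((-1 : ℝ) ^ (k : ℕ) • coframe i (frame (I k)) • coeff β (k.removeNth I)) ⬝ᵥ coeff α I =
      ∑ J, coeff β J ⬝ᵥ coeff α (Fin.cons i J) := by
    intro k
    -- Split `I` into its `k`-th entry and the rest; moving that entry to the front of the
    -- alternating `α` produces the sign which occurs in the wedge product.
    rw [← (Fin.insertNthEquiv (fun _ => Fin n) k).sum_comp, Fintype.sum_prod_type, Finset.sum_comm]
    refine Finset.sum_congr rfl fun J _ => ?_
    have e : ∀ x : Fin n × (Fin p → Fin n),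
        Fin.insertNthEquiv (fun _ => Fin n) k x = k.insertNth x.1 x.2 := fun _ => rfl
    simp only [e, Fin.insertNth_apply_same, Fin.removeNth_insertNth, coeff_insertNth,
      coframe_frame, smul_dotProduct, dotProduct_smul, smul_eq_mul]
    simp only [ite_mul, one_mul, zero_mul, mul_ite, mul_zero, Finset.sum_ite_eq, Finset.mem_univ,
      if_true]
    rw [← mul_assoc, ← mul_pow]
    simp
  simp only [coeff_wedge, sum_dotProduct]
  rw [Finset.sum_comm, Finset.sum_congr rfl fun k _ => key k]
  simp

/-- The quadratic form of `∑ i j, A_{ij} dx_i ∧ (∂/∂x_j ⌟ ·)` in terms of the coefficients. -/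
lemma formInner_wedgeContractOp (G : Matrix (Fin r) (Fin r) ℝ) (hG : G.IsSymm)
    (A : Fin n → Fin n → Matrix (Fin r) (Fin r) ℝ) (α : Form n r (p + 1)) :
    formInner G (wedgeContractOp A α) α =
      (p.factorial : ℝ)⁻¹ * ∑ J : Fin p → Fin n, ∑ i, ∑ j,
        coeff α (Fin.cons i J) ⬝ᵥ (G * A i j) *ᵥ coeff α (Fin.cons j J) := by
  have h1 : ∀ i j, ∑ I, coeff (wedge (coframe i) (actFibre (A i j) (contract (frame j) α))) I ⬝ᵥ
      G *ᵥ coeff α I = ((p : ℝ) + 1) * ∑ J,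
        coeff α (Fin.cons i J) ⬝ᵥ (G * A i j) *ᵥ coeff α (Fin.cons j J) := by
    intro i j
    have := sum_coeff_wedge_dotProduct i (actFibre (A i j) (contract (frame j) α)) (actFibre G α)
    simp only [coeff_actFibre, coeff_contract] at this ⊢
    rw [this]
    congr 1
    refine Finset.sum_congr rfl fun J _ => ?_
    rw [dotProduct_mulVec, ← mulVec_transpose, hG.eq, mulVec_mulVec, dotProduct_comm]
  have h2 : ((p + 1).factorial : ℝ)⁻¹ * ((p : ℝ) + 1) = (p.factorial : ℝ)⁻¹ := by
    rw [Nat.factorial_succ]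
    push_cast
    field_simp
  rw [formInner_eq_sum, ← h2, mul_assoc]
  congr 1
  simp only [wedgeContractOp, LinearMap.coe_mk, AddHom.coe_mk, coeff_sum, sum_dotProduct]
  rw [Finset.sum_comm, Finset.sum_comm (s := (Finset.univ : Finset (Fin p → Fin n))),
    Finset.mul_sum]
  refine Finset.sum_congr rfl fun i _ => ?_
  rw [Finset.sum_comm, Finset.sum_comm (s := (Finset.univ : Finset (Fin p → Fin n))),
    Finset.mul_sum]
  exact Finset.sum_congr rfl fun j _ => h1 i j

/-- `∑ i, dx_i ∧ (∂/∂x_i ⌟ ·)` multiplies a form by its degree. -/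
lemma wedgeContractOp_scalar (c : ℝ) (α : Form n r (p + 1)) :
    wedgeContractOp (fun i j => (c • (1 : Matrix (Fin n) (Fin n) ℝ)) i j •
      (1 : Matrix (Fin r) (Fin r) ℝ)) α = (c * ((p : ℝ) + 1)) • α := by
  have h : ∀ i j : Fin n, wedge (coframe i) (actFibre ((c • (1 : Matrix (Fin n) (Fin n) ℝ)) i j •
      (1 : Matrix (Fin r) (Fin r) ℝ)) (contract (frame j) α)) =
      if i = j then c • wedge (coframe i) (contract (frame i) α) else 0 := by
    intro i j
    by_cases hij : i = j
    · subst hij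
      ext v k
      simp [wedge, actFibre, ContinuousAlternatingMap.alternatizeUncurryFin_apply,
        Finset.mul_sum, mul_left_comm]
    · ext v k
      simp [wedge, actFibre, ContinuousAlternatingMap.alternatizeUncurryFin_apply, hij]
  have hsum : ∑ i, (coframe i).smulRight (contract (frame i) α) = α.curryLeft := by
    ext v w k
    have hv : v = ∑ i, v i • frame i := by
      ext k
      simp [frame_apply]
    conv_rhs => rw [hv, map_sum]
    simp [contract, coframe, ContinuousAlternatingMap.sum_apply]
  have h3 : ∑ i, wedge (coframe i) (contract (frame i) α) = ((p : ℝ) + 1) • α := by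
    have := ContinuousAlternatingMap.alternatizeUncurryFin_curryLeft α
    rw [← hsum, ← ContinuousAlternatingMap.alternatizeUncurryFinCLM_apply, map_sum] at this
    simp only [ContinuousAlternatingMap.alternatizeUncurryFinCLM_apply] at this
    rw [← Nat.cast_smul_eq_nsmul ℝ] at this
    simpa [wedge] using this
  simp only [wedgeContractOp, LinearMap.coe_mk, AddHom.coe_mk, h, Finset.sum_ite_eq,
    Finset.mem_univ, if_true]
  rw [← Finset.smul_sum, h3, smul_smul]

/-- `Hess_ψ⁻¹` is a scalar for a weight with Hessian matrix `c • 1`. -/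
lemma hessOpInv_of_hessMatrix {ψ : Rn n → ℝ} {x : Rn n} {c : ℝ} (hc : c ≠ 0)
    (h : hessMatrix ψ x = c • 1) (α : Form n r (p + 1)) :
    hessOpInv ψ x α = (c * ((p : ℝ) + 1))⁻¹ • α := by
  have hne : c * ((p : ℝ) + 1) ≠ 0 := mul_ne_zero hc (by positivity)
  have h1 : (hessOp ψ x : Module.End ℝ (Form n r (p + 1))) =
      (c * ((p : ℝ) + 1)) • (1 : Module.End ℝ (Form n r (p + 1))) := by
    ext1 β
    rw [hessOp, h, wedgeContractOp_scalar]
    rfl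
  have h2 : Ring.inverse (hessOp ψ x : Module.End ℝ (Form n r (p + 1))) =
      (c * ((p : ℝ) + 1))⁻¹ • (1 : Module.End ℝ (Form n r (p + 1))) := by
    let u : (Module.End ℝ (Form n r (p + 1)))ˣ :=
      ⟨(c * ((p : ℝ) + 1)) • 1, (c * ((p : ℝ) + 1))⁻¹ • 1,
        by rw [smul_mul_smul_comm, mul_inv_cancel₀ hne, one_smul, one_mul],
        by rw [smul_mul_smul_comm, inv_mul_cancel₀ hne, one_smul, one_mul]⟩
    rw [h1]
    exact Ring.inverse_unit u
  rw [hessOpInv, h2]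
  rfl

/-! ### Regularization of test functions -/

lemma integrable_smul_of_locallyIntegrableOn {E : Type*} [NormedAddCommGroup E] [NormedSpace ℝ E]
    {D : Set (Rn n)} {F : Rn n → E} {φ : Rn n → ℝ}
    (hF : LocallyIntegrableOn F D) (hφ : Continuous φ) (hc : HasCompactSupport φ)
    (hs : tsupport φ ⊆ D) : Integrable (fun x => φ x • F x) := by
  have h1 : IntegrableOn F (tsupport φ) := hF.integrableOn_compact_subset hs hc.isCompact
  have h2 := h1.continuousOn_smul hφ.continuousOn hc.isCompact
  refine (integrableOn_iff_integrable_of_support_subset ?_).1 h2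
  exact (Function.support_smul_subset_left _ _).trans (subset_tsupport φ)

lemma integrable_mul_of_locallyIntegrableOn {D : Set (Rn n)} {F φ : Rn n → ℝ}
    (hF : LocallyIntegrableOn F D) (hφ : Continuous φ) (hc : HasCompactSupport φ)
    (hs : tsupport φ ⊆ D) : Integrable (fun x => φ x * F x) :=
  integrable_smul_of_locallyIntegrableOn hF hφ hc hs

/-- A sequence of bump functions at the origin with supports shrinking to a point. -/
noncomputable def shrinkingBump (n : ℕ) {δ : ℝ} (hδ : 0 < δ) (k : ℕ) : ContDiffBump (0 : Rn n) where
  rIn := δ / (2 * (k + 1))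
  rOut := δ / (k + 1)
  rIn_pos := by positivity
  rIn_lt_rOut := by
    have : (0 : ℝ) < k + 1 := by positivity
    gcongr
    linarith

/-- The regularizations of a function by the normalized bump functions `shrinkingBump`. -/
noncomputable def mollify {δ : ℝ} (hδ : 0 < δ) (k : ℕ) (φ : Rn n → ℝ) : Rn n → ℝ :=
  (shrinkingBump n hδ k).normed volume ⋆[ContinuousLinearMap.lsmul ℝ ℝ, volume] φ

section mollify

variable {δ : ℝ} (hδ : 0 < δ) {φ : Rn n → ℝ}

lemma contDiff_mollify (k : ℕ) (hφ : Continuous φ) : ContDiff ℝ ∞ (mollify hδ k φ) :=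
  HasCompactSupport.contDiff_convolution_left (n := ⊤) _
    (shrinkingBump n hδ k).hasCompactSupport_normed
    (shrinkingBump n hδ k).contDiff_normed hφ.locallyIntegrable

lemma tsupport_mollify_subset (k : ℕ) {K : Set (Rn n)} (hK : tsupport φ ⊆ K) :
    tsupport (mollify hδ k φ) ⊆ cthickening δ K := by
  refine closure_minimal ?_ isClosed_cthickening
  refine (support_convolution_subset _).trans ?_
  rintro _ ⟨y, hy, z, hz, rfl⟩
  rw [ContDiffBump.support_normed_eq, mem_ball_zero_iff] at hy
  refine mem_cthickening_of_dist_le _ z δ K (hK (subset_tsupport φ hz)) ?_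
  have h1 : (shrinkingBump n hδ k).rOut ≤ δ := div_le_self hδ.le (by simp)
  simpa using hy.le.trans h1

lemma abs_mollify_le (k : ℕ) (hφ : Continuous φ) {C : ℝ} (hC : ∀ x, |φ x| ≤ C) (x : Rn n) :
    |mollify hδ k φ x| ≤ C := by
  have h0 : 0 ≤ C := (abs_nonneg _).trans (hC x)
  have := dist_convolution_le (μ := volume) (x₀ := x) (z₀ := 0) h0
    (shrinkingBump n hδ k).support_normed_eq.subset (shrinkingBump n hδ k).nonneg_normed
    (shrinkingBump n hδ k).integral_normed hφ.aestronglyMeasurable (fun y _ => by simpa using hC y)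
  simpa [mollify] using this

lemma tendsto_mollify (hφ : Continuous φ) (x : Rn n) :
    Tendsto (fun k => mollify hδ k φ x) atTop (𝓝 (φ x)) := by
  refine ContDiffBump.convolution_tendsto_right_of_continuous ?_ hφ x
  show Tendsto (fun k : ℕ => δ / ((k : ℝ) + 1)) atTop (𝓝 0)
  exact tendsto_const_div_atTop_nhds_zero_nat δ |>.comp (tendsto_add_atTop_nat 1) |>.congr
    fun k => by simp

lemma partialD_mollify (k : ℕ) (hφ : ContDiff ℝ 1 φ) (hc : HasCompactSupport φ) (i : Fin n) :
    partialD i (mollify hδ k φ) = mollify hδ k (partialD i φ) := by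
  ext x
  have hloc : LocallyIntegrable ((shrinkingBump n hδ k).normed volume) (volume : Measure (Rn n)) :=
    (shrinkingBump n hδ k).continuous_normed.locallyIntegrable
  have h := hc.hasFDerivAt_convolution_right (ContinuousLinearMap.lsmul ℝ ℝ) hloc hφ x
  unfold partialD
  rw [mollify, h.fderiv, convolution_precompR_apply _ hloc (hc.fderiv ℝ)
    (hφ.continuous_fderiv one_ne_zero)]
  rfl

lemma tendsto_integral_mollify_mul {D : Set (Rn n)} {F : Rn n → ℝ}
    (hF : LocallyIntegrableOn F D) (hφ : Continuous φ) (hc : HasCompactSupport φ) {K : Set (Rn n)}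
    (hφK : tsupport φ ⊆ K) (hK : IsCompact K) (hKD : cthickening δ K ⊆ D) :
    Tendsto (fun k => ∫ x in D, mollify hδ k φ x * F x) atTop (𝓝 (∫ x in D, φ x * F x)) := by
  obtain ⟨C, hC⟩ := hφ.bounded_above_of_compact_support hc
  have hK' : IsCompact (cthickening δ K) := hK.cthickening
  have hFi : Integrable ((cthickening δ K).indicator fun x => C * |F x|) := by
    rw [integrable_indicator_iff isClosed_cthickening.measurableSet]
    exact ((hF.integrableOn_compact_subset hKD hK').abs).const_mul C
  refine tendsto_integral_of_dominated_convergence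
    ((cthickening δ K).indicator fun x => C * |F x|) ?_ hFi.integrableOn ?_ ?_
  · intro k
    have hcs : HasCompactSupport (mollify hδ k φ) :=
      HasCompactSupport.of_support_subset_isCompact hK'
        ((subset_tsupport _).trans (tsupport_mollify_subset hδ k hφK))
    exact (integrable_mul_of_locallyIntegrableOn hF (contDiff_mollify hδ k hφ).continuous hcs
      ((tsupport_mollify_subset hδ k hφK).trans hKD)).aestronglyMeasurable.restrict
  · intro k
    refine Eventually.of_forall fun x => ?_
    by_cases hx : x ∈ cthickening δ K
    · rw [Set.indicator_of_mem hx, Real.norm_eq_abs, abs_mul]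
      exact mul_le_mul_of_nonneg_right (abs_mollify_le hδ k hφ hC x) (abs_nonneg _)
    · have : mollify hδ k φ x = 0 :=
        image_eq_zero_of_notMem_tsupport fun h => hx (tsupport_mollify_subset hδ k hφK h)
      simp [hx, this]
  · exact Eventually.of_forall fun x => (tendsto_mollify hδ hφ x).mul_const _

end mollify

lemma continuous_partialD {φ : Rn n → ℝ} (hφ : ContDiff ℝ 1 φ) (i : Fin n) :
    Continuous (partialD i φ) :=
  (hφ.continuous_fderiv one_ne_zero).clm_apply continuous_const

lemma tsupport_partialD_subset (φ : Rn n → ℝ) (i : Fin n) :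
    tsupport (partialD i φ) ⊆ tsupport φ :=
  tsupport_fderiv_apply_subset ℝ (frame i)

lemma hasCompactSupport_partialD {φ : Rn n → ℝ} (hc : HasCompactSupport φ) (i : Fin n) :
    HasCompactSupport (partialD i φ) :=
  hc.fderiv_apply ℝ (frame i)

/-- A weak identity `∑ i, ∂_i U_i = F` which is known for smooth test functions holds for `C¹` test
functions, by regularization. This is needed because the test functions which arise from a `C²`
metric are only `C²`. -/
lemma integral_mul_eq_of_contDiff_one {D : Set (Rn n)} (hD : IsOpen D) {F : Rn n → ℝ}
    {U : Fin n → Rn n → ℝ} (hF : LocallyIntegrableOn F D) (hU : ∀ i, LocallyIntegrableOn (U i) D)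
    (h : ∀ φ : Rn n → ℝ, ContDiff ℝ ∞ φ → HasCompactSupport φ → tsupport φ ⊆ D →
      ∫ x in D, φ x * F x = -∫ x in D, ∑ i, partialD i φ x * U i x)
    {φ : Rn n → ℝ} (hφ : ContDiff ℝ 1 φ) (hc : HasCompactSupport φ) (hs : tsupport φ ⊆ D) :
    ∫ x in D, φ x * F x = -∫ x in D, ∑ i, partialD i φ x * U i x := by
  obtain ⟨δ, hδ, hδD⟩ := hc.isCompact.exists_cthickening_subset_open hD hs
  have hsum : ∀ ψ : Rn n → ℝ, ContDiff ℝ 1 ψ → HasCompactSupport ψ → tsupport ψ ⊆ D →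
      ∫ x in D, ∑ i, partialD i ψ x * U i x = ∑ i, ∫ x in D, partialD i ψ x * U i x := by
    intro ψ hψ hψc hψs
    exact integral_finsetSum _ fun i _ => (integrable_mul_of_locallyIntegrableOn (hU i)
      (continuous_partialD hψ i) (hasCompactSupport_partialD hψc i)
      ((tsupport_partialD_subset ψ i).trans hψs)).integrableOn
  have hmc : ∀ k, HasCompactSupport (mollify hδ k φ) := fun k =>
    HasCompactSupport.of_support_subset_isCompact hc.isCompact.cthickening
      ((subset_tsupport _).trans (tsupport_mollify_subset hδ k subset_rfl))
  have hms : ∀ k, tsupport (mollify hδ k φ) ⊆ D := fun k =>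
    (tsupport_mollify_subset hδ k subset_rfl).trans hδD
  have hmd : ∀ k, ContDiff ℝ ∞ (mollify hδ k φ) := fun k => contDiff_mollify hδ k hφ.continuous
  have h1 := tendsto_integral_mollify_mul hδ hF hφ.continuous hc subset_rfl hc.isCompact hδD
  have h2 : Tendsto (fun k => -∑ i, ∫ x in D, mollify hδ k (partialD i φ) x * U i x) atTop
      (𝓝 (-∑ i, ∫ x in D, partialD i φ x * U i x)) :=
    (tendsto_finsetSum _ fun i _ => tendsto_integral_mollify_mul hδ (hU i)
      (continuous_partialD hφ i) (hasCompactSupport_partialD hc i) (tsupport_partialD_subset φ i)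
      hc.isCompact hδD).neg
  rw [hsum φ hφ hc hs]
  refine tendsto_nhds_unique (h1.congr fun k => ?_) h2
  rw [h _ (hmd k) (hmc k) (hms k),
    hsum _ ((hmd k).of_le (by exact_mod_cast le_top)) (hmc k) (hms k)]
  simp only [partialD_mollify hδ k hφ hc]

/-! ### Integration by parts and the Bochner formula -/

lemma partialD_mul {a b : Rn n → ℝ} {x : Rn n} (ha : DifferentiableAt ℝ a x)
    (hb : DifferentiableAt ℝ b x) (i : Fin n) :
    partialD i (fun y => a y * b y) x = partialD i a x * b x + a x * partialD i b x := by
  simp only [partialD, fderiv_fun_mul ha hb]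
  simp
  ring

lemma partialD_add {a b : Rn n → ℝ} {x : Rn n} (ha : DifferentiableAt ℝ a x)
    (hb : DifferentiableAt ℝ b x) (i : Fin n) :
    partialD i (fun y => a y + b y) x = partialD i a x + partialD i b x := by
  simp [partialD, fderiv_fun_add ha hb]

lemma partialD_sub {a b : Rn n → ℝ} {x : Rn n} (ha : DifferentiableAt ℝ a x)
    (hb : DifferentiableAt ℝ b x) (i : Fin n) :
    partialD i (fun y => a y - b y) x = partialD i a x - partialD i b x := by
  simp [partialD, fderiv_fun_sub ha hb]

lemma partialD_sum {ι : Type*} {s : Finset ι} {a : ι → Rn n → ℝ} {x : Rn n}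
    (ha : ∀ k ∈ s, DifferentiableAt ℝ (a k) x) (i : Fin n) :
    partialD i (fun y => ∑ k ∈ s, a k y) x = ∑ k ∈ s, partialD i (a k) x := by
  simp only [partialD, fderiv_fun_sum ha]
  simp

lemma partialD_congr {a b : Rn n → ℝ} {x : Rn n} (h : a =ᶠ[𝓝 x] b) (i : Fin n) :
    partialD i a x = partialD i b x := by
  simp only [partialD, h.fderiv_eq]

lemma contDiff_partialD {φ : Rn n → ℝ} {m k : ℕ∞} (hφ : ContDiff ℝ m φ) (hk : k + 1 ≤ m)
    (i : Fin n) : ContDiff ℝ k (partialD i φ) :=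
  (hφ.fderiv_right (by exact_mod_cast hk)).clm_apply contDiff_const

lemma partialD_comm {φ : Rn n → ℝ} (hφ : ContDiff ℝ 2 φ) (i j : Fin n) (x : Rn n) :
    partialD i (partialD j φ) x = partialD j (partialD i φ) x := by
  have hd : DifferentiableAt ℝ (fderiv ℝ φ) x :=
    ((hφ.fderiv_right (m := 1) (by norm_num)).differentiable one_ne_zero) x
  have h : ∀ i j, partialD i (partialD j φ) x = fderiv ℝ (fderiv ℝ φ) x (frame i) (frame j) := by
    intro i j
    have : partialD j φ = fun y => fderiv ℝ φ y (frame j) := rfl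
    rw [this, partialD, fderiv_clm_apply hd (differentiableAt_const _)]
    simp
  rw [h, h]
  exact (hφ.contDiffAt.isSymmSndFDerivAt (by simp)) _ _

/-- Integration by parts. -/
lemma integral_partialD_mul {a X : Rn n → ℝ} (ha : ContDiff ℝ 1 a) (hc : HasCompactSupport a)
    (hX : ContDiff ℝ 1 X) (i : Fin n) :
    ∫ x, partialD i a x * X x = -∫ x, a x * partialD i X x := by
  have hca := continuous_partialD ha i
  have hcX := continuous_partialD hX i
  rw [eq_comm, neg_eq_iff_eq_neg]
  exact integral_mul_fderiv_eq_neg_fderiv_mul_of_integrable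
    ((hca.mul hX.continuous).integrable_of_hasCompactSupport
      ((hasCompactSupport_partialD hc i).mul_right))
    ((ha.continuous.mul hcX).integrable_of_hasCompactSupport hc.mul_right)
    ((ha.continuous.mul hX.continuous).integrable_of_hasCompactSupport hc.mul_right)
    (fun x _ => ha.differentiable one_ne_zero x) (fun x _ => hX.differentiable one_ne_zero x)

/-- The integrand of the divergence `∂_i(a ∂_j(φ b)) - ∂_j(a φ ∂_i b)`. -/
noncomputable def divIntegrand (φ a b : Rn n → ℝ) (i j : Fin n) (x : Rn n) : ℝ :=
  partialD i a x * partialD j φ x * b x + partialD i a x * φ x * partialD j b x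
    + a x * partialD i (partialD j φ) x * b x + a x * partialD i φ x * partialD j b x
    - partialD j a x * φ x * partialD i b x

lemma continuous_divIntegrand {φ a b : Rn n → ℝ} (hφ : ContDiff ℝ 2 φ) (ha : ContDiff ℝ 2 a)
    (hb : ContDiff ℝ 2 b) (i j : Fin n) : Continuous (divIntegrand φ a b i j) := by
  have h1 : ∀ {c : Rn n → ℝ}, ContDiff ℝ 2 c → ∀ k, Continuous (partialD k c) := fun hc k =>
    continuous_partialD (hc.of_le one_le_two) k
  have h2 : Continuous (partialD i (partialD j φ)) :=
    continuous_partialD (contDiff_partialD (m := 2) (k := 1) hφ (by norm_num) j) i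
  have := h1 hφ i
  have := h1 hφ j
  have := h1 ha i
  have := h1 ha j
  have := h1 hb i
  have := h1 hb j
  have := hφ.continuous
  have := ha.continuous
  have := hb.continuous
  unfold divIntegrand
  fun_prop

lemma hasCompactSupport_divIntegrand {φ a b : Rn n → ℝ} (hc : HasCompactSupport a) (i j : Fin n) :
    HasCompactSupport (divIntegrand φ a b i j) := by
  refine HasCompactSupport.intro hc fun x hx => ?_
  have h : ∀ k, partialD k a x = 0 := fun k =>
    image_eq_zero_of_notMem_tsupport fun h => hx (tsupport_partialD_subset a k h)
  simp [divIntegrand, h, image_eq_zero_of_notMem_tsupport hx]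

lemma integral_divIntegrand {φ a b : Rn n → ℝ} (hφ : ContDiff ℝ 2 φ) (ha : ContDiff ℝ 2 a)
    (hca : HasCompactSupport a) (hb : ContDiff ℝ 2 b) (i j : Fin n) :
    ∫ x, divIntegrand φ a b i j x = 0 := by
  have hd : ∀ {c : Rn n → ℝ}, ContDiff ℝ 2 c → Differentiable ℝ c := fun hc =>
    hc.differentiable two_ne_zero
  have hp : ∀ {c : Rn n → ℝ}, ContDiff ℝ 2 c → ∀ k, ContDiff ℝ 1 (partialD k c) := fun hc k =>
    contDiff_partialD (m := 2) (k := 1) hc (by norm_num) k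
  have hpd : ∀ {c : Rn n → ℝ}, ContDiff ℝ 2 c → ∀ k, Differentiable ℝ (partialD k c) := fun hc k =>
    (hp hc k).differentiable one_ne_zero
  set X : Rn n → ℝ := fun x => partialD j φ x * b x + φ x * partialD j b x with hXdef
  set Y : Rn n → ℝ := fun x => φ x * partialD i b x with hYdef
  have ha1 := ha.of_le (one_le_two)
  have hb1 := hb.of_le (one_le_two)
  have hφ1 := hφ.of_le (one_le_two)
  have hX : ContDiff ℝ 1 X := ((hp hφ j).mul hb1).add (hφ1.mul (hp hb j))
  have hY : ContDiff ℝ 1 Y := hφ1.mul (hp hb i)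
  have h1 := integral_partialD_mul ha1 hca hX i
  have h2 := integral_partialD_mul ha1 hca hY j
  have i1 : Integrable fun x => partialD i a x * X x :=
    ((continuous_partialD ha1 i).mul hX.continuous).integrable_of_hasCompactSupport
      (hasCompactSupport_partialD hca i).mul_right
  have i2 : Integrable fun x => a x * partialD i X x :=
    (ha.continuous.mul (continuous_partialD hX i)).integrable_of_hasCompactSupport hca.mul_right
  have i3 : Integrable fun x => partialD j a x * Y x :=
    ((continuous_partialD ha1 j).mul hY.continuous).integrable_of_hasCompactSupport
      (hasCompactSupport_partialD hca j).mul_right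
  have i4 : Integrable fun x => a x * partialD j Y x :=
    (ha.continuous.mul (continuous_partialD hY j)).integrable_of_hasCompactSupport hca.mul_right
  have e : ∀ x, divIntegrand φ a b i j x = (partialD i a x * X x + a x * partialD i X x)
      - (partialD j a x * Y x + a x * partialD j Y x) := by
    intro x
    have eX : partialD i X x = partialD i (partialD j φ) x * b x + partialD j φ x * partialD i b x
        + (partialD i φ x * partialD j b x + φ x * partialD i (partialD j b) x) := by
      rw [hXdef, partialD_add ((hpd hφ j x).fun_mul (hd hb x)) ((hd hφ x).fun_mul (hpd hb j x)),
        partialD_mul (hpd hφ j x) (hd hb x), partialD_mul (hd hφ x) (hpd hb j x)]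
    have eY : partialD j Y x = partialD j φ x * partialD i b x
        + φ x * partialD i (partialD j b) x := by
      rw [hYdef, partialD_mul (hd hφ x) (hpd hb i x), partialD_comm hb j i]
    rw [eX, eY, hXdef, hYdef, divIntegrand]
    ring
  simp_rw [e]
  have i5 : Integrable fun x => partialD i a x * X x + a x * partialD i X x := i1.add i2
  have i6 : Integrable fun x => partialD j a x * Y x + a x * partialD j Y x := i3.add i4
  rw [integral_sub i5 i6, integral_add i1 i2, integral_add i3 i4, h1, h2]
  ring

lemma dotProduct_mulVec_eq_sum (M : Matrix (Fin r) (Fin r) ℝ) (v w : Fin r → ℝ) :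
    v ⬝ᵥ M *ᵥ w = ∑ τ, ∑ ξ, v τ * M τ ξ * w ξ := by
  simp only [dotProduct, mulVec, Finset.mul_sum, mul_assoc]

/-- The componentwise partial derivative `∂v/∂x_i` of an `ℝ^r`-valued function. -/
noncomputable def partialDVec (i : Fin n) (v : Rn n → Fin r → ℝ) (x : Rn n) : Fin r → ℝ :=
  fun τ => partialD i (fun y => v y τ) x

lemma partialDVec_mulVec {H : Rn n → Matrix (Fin r) (Fin r) ℝ} {v : Rn n → Fin r → ℝ} {x : Rn n}
    (hH : ∀ τ ξ, DifferentiableAt ℝ (fun y => H y τ ξ) x)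
    (hv : ∀ τ, DifferentiableAt ℝ (fun y => v y τ) x) (i : Fin n) :
    partialDVec i (fun y => H y *ᵥ v y) x =
      partialDMat i H x *ᵥ v x + H x *ᵥ partialDVec i v x := by
  ext τ
  simp only [partialDVec, mulVec, dotProduct, Pi.add_apply, partialDMat, of_apply]
  rw [partialD_sum fun ξ _ => (hH τ ξ).fun_mul (hv ξ), ← Finset.sum_add_distrib]
  exact Finset.sum_congr rfl fun ξ _ => partialD_mul (hH τ ξ) (hv ξ) i

/-- The integrand to which integration by parts transforms `|∑ i, H⁻¹ ∂_i(H v_i)|²_H`: a term in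
the flat derivatives `∂_j v_i` of the fields, and a curvature term of order zero, since
`∂_i H H⁻¹ ∂_j H - ∂_i ∂_j H = -H ∂_i(H⁻¹ ∂_j H)`. -/
noncomputable def bochnerIntegrand (H : Rn n → Matrix (Fin r) (Fin r) ℝ)
    (v : Fin n → Rn n → Fin r → ℝ) (x : Rn n) : ℝ :=
  ∑ i, ∑ j, (partialDVec j (v i) x ⬝ᵥ H x *ᵥ partialDVec i (v j) x +
    v i x ⬝ᵥ (partialDMat i H x * (H x)⁻¹ * partialDMat j H x -
      partialDMat i (partialDMat j H) x) *ᵥ v j x)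

/-- The sum `∑ i, ∂_i(H v_i)`, which is `-H` times the formal adjoint of the differential with
respect to the metric `H`. -/
noncomputable def metricDiv (H : Rn n → Matrix (Fin r) (Fin r) ℝ)
    (v : Fin n → Rn n → Fin r → ℝ) (x : Rn n) : Fin r → ℝ :=
  ∑ i, partialDVec i (fun y => H y *ᵥ v i y) x

/-- The pointwise Bochner formula. -/
lemma metricDiv_dotProduct_eq {H : Rn n → Matrix (Fin r) (Fin r) ℝ} {v : Fin n → Rn n → Fin r → ℝ}
    {x : Rn n} (hH : ∀ τ ξ, ContDiff ℝ 2 fun y => H y τ ξ)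
    (hv : ∀ i τ, ContDiff ℝ 2 fun y => v i y τ) (hpos : ∀ x, (H x).PosDef) :
    metricDiv H v x ⬝ᵥ (H x)⁻¹ *ᵥ metricDiv H v x = bochnerIntegrand H v x +
      ∑ i, ∑ j, ∑ τ, ∑ ξ,
        divIntegrand (fun y => H y τ ξ) (fun y => v i y τ) (fun y => v j y ξ) i j x := by
  have hsymm : ∀ y, (H y)ᵀ = H y := fun y => by
    simpa [conjTranspose_eq_transpose_of_trivial] using (hpos y).isHermitian.eq
  have hsymm' : ∀ i, (partialDMat i H x)ᵀ = partialDMat i H x := by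
    intro i
    ext τ ξ
    simp only [transpose_apply, partialDMat, of_apply]
    congr 1
    ext y
    exact congrFun (congrFun (hsymm y) τ) ξ
  have hunit : IsUnit (H x).det := (isUnit_iff_isUnit_det _).1 (hpos x).isUnit
  have hinvT : ((H x)⁻¹)ᵀ = (H x)⁻¹ := by rw [transpose_nonsing_inv, hsymm]
  have hadj : ∀ (M : Matrix (Fin r) (Fin r) ℝ) (a b : Fin r → ℝ), Mᵀ = M →
      M *ᵥ a ⬝ᵥ b = a ⬝ᵥ M *ᵥ b := by
    intro M a b hM
    rw [dotProduct_mulVec, ← mulVec_transpose, hM]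
  have hy : metricDiv H v x = ∑ i, partialDMat i H x *ᵥ v i x +
      H x *ᵥ ∑ i, partialDVec i (v i) x := by
    unfold metricDiv
    rw [mulVec_sum, ← Finset.sum_add_distrib]
    exact Finset.sum_congr rfl fun i _ => partialDVec_mulVec
      (fun τ ξ => (hH τ ξ).differentiable two_ne_zero x)
      (fun τ => (hv i τ).differentiable two_ne_zero x) i
  set A := ∑ i, partialDMat i H x *ᵥ v i x with hA
  set B := ∑ i, partialDVec i (v i) x with hB
  have h1 : metricDiv H v x ⬝ᵥ (H x)⁻¹ *ᵥ metricDiv H v x =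
      A ⬝ᵥ (H x)⁻¹ *ᵥ A + A ⬝ᵥ B + B ⬝ᵥ A + B ⬝ᵥ H x *ᵥ B := by
    rw [hy, mulVec_add, mulVec_mulVec, nonsing_inv_mul _ hunit, one_mulVec, add_dotProduct,
      dotProduct_add, dotProduct_add, hadj _ B _ (hsymm x), hadj _ B _ (hsymm x), mulVec_mulVec,
      mul_nonsing_inv _ hunit, one_mulVec]
    ring
  have h2 : A ⬝ᵥ (H x)⁻¹ *ᵥ A = ∑ i, ∑ j,
      v i x ⬝ᵥ (partialDMat i H x * (H x)⁻¹ * partialDMat j H x) *ᵥ v j x := by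
    rw [hA, sum_dotProduct]
    refine Finset.sum_congr rfl fun i _ => ?_
    rw [mulVec_sum, dotProduct_sum]
    refine Finset.sum_congr rfl fun j _ => ?_
    rw [hadj _ _ _ (hsymm' i), mulVec_mulVec, mulVec_mulVec, Matrix.mul_assoc]
  have h3 : A ⬝ᵥ B = ∑ i, ∑ j, v i x ⬝ᵥ partialDMat i H x *ᵥ partialDVec j (v j) x := by
    rw [hA, sum_dotProduct]
    refine Finset.sum_congr rfl fun i _ => ?_
    rw [hB, dotProduct_sum]
    exact Finset.sum_congr rfl fun j _ => hadj _ _ _ (hsymm' i)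
  have h4 : B ⬝ᵥ A = ∑ i, ∑ j, partialDVec i (v i) x ⬝ᵥ partialDMat j H x *ᵥ v j x := by
    rw [hB, sum_dotProduct]
    exact Finset.sum_congr rfl fun i _ => by rw [hA, dotProduct_sum]
  have h5 : B ⬝ᵥ H x *ᵥ B =
      ∑ i, ∑ j, partialDVec i (v i) x ⬝ᵥ H x *ᵥ partialDVec j (v j) x := by
    rw [hB, sum_dotProduct]
    exact Finset.sum_congr rfl fun i _ => by rw [mulVec_sum, dotProduct_sum]
  rw [h1, h2, h3, h4, h5, bochnerIntegrand]
  simp only [← Finset.sum_add_distrib]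
  refine Finset.sum_congr rfl fun i _ => Finset.sum_congr rfl fun j _ => ?_
  rw [sub_mulVec, dotProduct_sub]
  generalize v i x ⬝ᵥ (partialDMat i H x * (H x)⁻¹ * partialDMat j H x) *ᵥ v j x = K
  simp only [dotProduct_mulVec_eq_sum, divIntegrand, Finset.sum_add_distrib,
    Finset.sum_sub_distrib, partialDVec, partialDMat, of_apply]
  ring

/-! ### The integrated Bochner formula and weighted metrics -/

section Bochner

variable {H : Rn n → Matrix (Fin r) (Fin r) ℝ} {v : Fin n → Rn n → Fin r → ℝ}

lemma continuous_partialDMat (hH : ∀ τ ξ, ContDiff ℝ 1 fun y => H y τ ξ) (i : Fin n) :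
    Continuous (partialDMat i H) :=
  continuous_matrix fun τ ξ => continuous_partialD (hH τ ξ) i

lemma continuous_partialDVec {w : Rn n → Fin r → ℝ} (hw : ∀ τ, ContDiff ℝ 1 fun y => w y τ)
    (i : Fin n) : Continuous (partialDVec i w) :=
  continuous_pi fun τ => continuous_partialD (hw τ) i

lemma continuous_matrix_inv_of_posDef (hH : ∀ τ ξ, Continuous fun y => H y τ ξ)
    (hpos : ∀ x, (H x).PosDef) : Continuous fun x => (H x)⁻¹ := by
  have hc : Continuous H := continuous_matrix hH
  simp only [inv_def, Ring.inverse_eq_inv]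
  exact (hc.matrix_det.inv₀ fun x => (hpos x).det_pos.ne').smul hc.matrix_adjugate

lemma continuous_bochnerIntegrand (hH : ∀ τ ξ, ContDiff ℝ 2 fun y => H y τ ξ)
    (hv : ∀ i τ, ContDiff ℝ 2 fun y => v i y τ) (hpos : ∀ x, (H x).PosDef) :
    Continuous (bochnerIntegrand H v) := by
  have h0 : Continuous H := continuous_matrix fun τ ξ => (hH τ ξ).continuous
  have hinv := continuous_matrix_inv_of_posDef (fun τ ξ => (hH τ ξ).continuous) hpos
  have h1 := fun i => continuous_partialDMat (fun τ ξ => (hH τ ξ).of_le one_le_two) i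
  have h2 : ∀ i j, Continuous (partialDMat i (partialDMat j H)) := fun i j =>
    continuous_partialDMat (fun τ ξ => contDiff_partialD (m := 2) (k := 1) (hH τ ξ)
      (by norm_num) j) i
  have h3 : ∀ i, Continuous (v i) := fun i => continuous_pi fun τ => (hv i τ).continuous
  have h4 : ∀ i j, Continuous (partialDVec j (v i)) := fun i j =>
    continuous_partialDVec (fun τ => (hv i τ).of_le one_le_two) j
  unfold bochnerIntegrand
  refine continuous_finsetSum _ fun i _ => continuous_finsetSum _ fun j _ => Continuous.add ?_ ?_
  · exact (h4 i j).dotProduct (h0.matrix_mulVec (h4 j i))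
  · exact (h3 i).dotProduct (((((h1 i).matrix_mul hinv).matrix_mul (h1 j)).sub
      (h2 i j)).matrix_mulVec (h3 j))

lemma contDiff_mulVec (hH : ∀ τ ξ, ContDiff ℝ 2 fun y => H y τ ξ) {w : Rn n → Fin r → ℝ}
    (hw : ∀ τ, ContDiff ℝ 2 fun y => w y τ) (τ : Fin r) :
    ContDiff ℝ 2 fun y => (H y *ᵥ w y) τ := by
  simp only [mulVec, dotProduct]
  exact ContDiff.sum fun ξ _ => (hH τ ξ).mul (hw ξ)

lemma continuous_metricDiv (hH : ∀ τ ξ, ContDiff ℝ 2 fun y => H y τ ξ)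
    (hv : ∀ i τ, ContDiff ℝ 2 fun y => v i y τ) : Continuous (metricDiv H v) := by
  unfold metricDiv
  exact continuous_finsetSum _ fun i _ => continuous_partialDVec
    (fun τ => (contDiff_mulVec hH (hv i) τ).of_le one_le_two) i

lemma partialDVec_eq_zero {w : Rn n → Fin r → ℝ} {x : Rn n} (hx : x ∉ tsupport w) (i : Fin n) :
    partialDVec i w x = 0 := by
  ext τ
  refine image_eq_zero_of_notMem_tsupport (f := partialD i fun y => w y τ) fun h => hx ?_
  have hsub : Function.support (fun y => w y τ) ⊆ Function.support w :=
    fun y hy h0 => hy (by simp [h0])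
  exact closure_mono hsub (tsupport_partialD_subset _ i h)

lemma bochnerIntegrand_eq_zero {x : Rn n} (hx : ∀ i, x ∉ tsupport (v i)) :
    bochnerIntegrand H v x = 0 := by
  simp [bochnerIntegrand, partialDVec_eq_zero (hx _), image_eq_zero_of_notMem_tsupport (hx _)]

lemma metricDiv_eq_zero {x : Rn n} (hx : ∀ i, x ∉ tsupport (v i)) :
    metricDiv H v x = 0 := by
  unfold metricDiv
  refine Finset.sum_eq_zero fun i _ => partialDVec_eq_zero (fun h => hx i ?_) i
  have hsub : Function.support (fun y => H y *ᵥ v i y) ⊆ Function.support (v i) :=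
    fun y hy h0 => hy (by simp [h0])
  exact closure_mono hsub h

lemma hasCompactSupport_bochnerIntegrand {K : Set (Rn n)} (hK : IsCompact K)
    (hvK : ∀ i, tsupport (v i) ⊆ K) : HasCompactSupport (bochnerIntegrand H v) :=
  HasCompactSupport.intro hK fun _ hx => bochnerIntegrand_eq_zero fun i h => hx (hvK i h)

lemma hasCompactSupport_metricDiv {K : Set (Rn n)} (hK : IsCompact K)
    (hvK : ∀ i, tsupport (v i) ⊆ K) :
    HasCompactSupport fun x => metricDiv H v x ⬝ᵥ (H x)⁻¹ *ᵥ metricDiv H v x :=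
  HasCompactSupport.intro hK fun _ hx => by
    simp [metricDiv_eq_zero (H := H) (v := v) fun i h => hx (hvK i h)]

lemma integrable_metricDiv (hH : ∀ τ ξ, ContDiff ℝ 2 fun y => H y τ ξ)
    (hv : ∀ i τ, ContDiff ℝ 2 fun y => v i y τ) (hpos : ∀ x, (H x).PosDef)
    {K : Set (Rn n)} (hK : IsCompact K) (hvK : ∀ i, tsupport (v i) ⊆ K) :
    Integrable fun x => metricDiv H v x ⬝ᵥ (H x)⁻¹ *ᵥ metricDiv H v x := by
  have hc := continuous_metricDiv hH hv
  have hinv := continuous_matrix_inv_of_posDef (fun τ ξ => (hH τ ξ).continuous) hpos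
  exact (hc.dotProduct (hinv.matrix_mulVec hc)).integrable_of_hasCompactSupport
    (hasCompactSupport_metricDiv hK hvK)

/-- The integrated Bochner formula. -/
lemma integral_metricDiv (hH : ∀ τ ξ, ContDiff ℝ 2 fun y => H y τ ξ)
    (hv : ∀ i τ, ContDiff ℝ 2 fun y => v i y τ) (hpos : ∀ x, (H x).PosDef)
    {K : Set (Rn n)} (hK : IsCompact K) (hvK : ∀ i, tsupport (v i) ⊆ K) :
    ∫ x, metricDiv H v x ⬝ᵥ (H x)⁻¹ *ᵥ metricDiv H v x = ∫ x, bochnerIntegrand H v x := by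
  have hcs : ∀ i τ, HasCompactSupport fun y => v i y τ := fun i τ =>
    HasCompactSupport.intro hK fun x hx => by
      simp [image_eq_zero_of_notMem_tsupport fun h => hx (hvK i h)]
  have hint : ∀ i j τ ξ, Integrable (divIntegrand (fun y => H y τ ξ) (fun y => v i y τ)
      (fun y => v j y ξ) i j) := fun i j τ ξ =>
    (continuous_divIntegrand (hH τ ξ) (hv i τ) (hv j ξ) i j).integrable_of_hasCompactSupport
      (hasCompactSupport_divIntegrand (hcs i τ) i j)
  have hB : Integrable (bochnerIntegrand H v) :=
    (continuous_bochnerIntegrand hH hv hpos).integrable_of_hasCompactSupport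
      (hasCompactSupport_bochnerIntegrand hK hvK)
  simp_rw [metricDiv_dotProduct_eq hH hv hpos]
  rw [integral_add hB (integrable_finsetSum _ fun i _ => integrable_finsetSum _ fun j _ =>
    integrable_finsetSum _ fun τ _ => integrable_finsetSum _ fun ξ _ => hint i j τ ξ)]
  rw [integral_finsetSum _ fun i _ => integrable_finsetSum _ fun j _ =>
    integrable_finsetSum _ fun τ _ => integrable_finsetSum _ fun ξ _ => hint i j τ ξ]
  rw [Finset.sum_eq_zero, add_zero]
  intro i _
  rw [integral_finsetSum _ fun j _ =>
    integrable_finsetSum _ fun τ _ => integrable_finsetSum _ fun ξ _ => hint i j τ ξ]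
  refine Finset.sum_eq_zero fun j _ => ?_
  rw [integral_finsetSum _ fun τ _ => integrable_finsetSum _ fun ξ _ => hint i j τ ξ]
  refine Finset.sum_eq_zero fun τ _ => ?_
  rw [integral_finsetSum _ fun ξ _ => hint i j τ ξ]
  exact Finset.sum_eq_zero fun ξ _ =>
    integral_divIntegrand (hH τ ξ) (hv i τ) (hcs i τ) (hv j ξ) i j

end Bochner

section weight

variable {G : Rn n → Matrix (Fin r) (Fin r) ℝ} {ψ : Rn n → ℝ}

lemma partialD_exp_neg {x : Rn n} (hψ : DifferentiableAt ℝ ψ x) (i : Fin n) :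
    partialD i (fun y => Real.exp (-ψ y)) x = -(Real.exp (-ψ x) * partialD i ψ x) := by
  have := (hψ.hasFDerivAt.neg.exp).fderiv
  simp only [partialD]
  rw [show (fun y => Real.exp (-ψ y)) = fun y => Real.exp ((-ψ) y) from rfl, this]
  simp

lemma partialDMat_exp_smul {x : Rn n} (hG : ∀ τ ξ, DifferentiableAt ℝ (fun y => G y τ ξ) x)
    (hψ : DifferentiableAt ℝ ψ x) (i : Fin n) :
    partialDMat i (fun y => Real.exp (-ψ y) • G y) x =
      Real.exp (-ψ x) • (partialDMat i G x - partialD i ψ x • G x) := by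
  ext τ ξ
  change partialD i (fun y => Real.exp (-ψ y) * G y τ ξ) x =
    Real.exp (-ψ x) * (partialD i (fun y => G y τ ξ) x - partialD i ψ x * G x τ ξ)
  have he : DifferentiableAt ℝ (fun y => Real.exp (-ψ y)) x := hψ.neg.exp
  rw [partialD_mul he (hG τ ξ), partialD_exp_neg hψ]
  ring

/-- Multiplying the metric by `e^{-ψ}` adds the Hessian of `ψ` to the curvature; the terms with
first derivatives of `ψ` cancel. -/
lemma bochnerIntegrand_exp_smul {v : Fin n → Rn n → Fin r → ℝ}
    (hG : ∀ τ ξ, ContDiff ℝ 2 fun y => G y τ ξ) (hpos : ∀ x, (G x).PosDef)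
    (hψ : ContDiff ℝ 2 ψ) {c : ℝ} {x : Rn n} (hc : hessMatrix ψ x = c • 1) :
    bochnerIntegrand (fun y => Real.exp (-ψ y) • G y) v x =
      Real.exp (-ψ x) * (bochnerIntegrand G v x + c * ∑ i, v i x ⬝ᵥ G x *ᵥ v i x) := by
  have hGd : ∀ x τ ξ, DifferentiableAt ℝ (fun y => G y τ ξ) x := fun x τ ξ =>
    (hG τ ξ).differentiable two_ne_zero x
  have hψd : ∀ x, DifferentiableAt ℝ ψ x := fun x => hψ.differentiable two_ne_zero x
  have hGd2 : ∀ j x τ ξ, DifferentiableAt ℝ (fun y => partialDMat j G y τ ξ) x := fun j x τ ξ =>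
    (contDiff_partialD (m := 2) (k := 1) (hG τ ξ) (by norm_num) j).differentiable one_ne_zero x
  have hψd2 : ∀ j x, DifferentiableAt ℝ (partialD j ψ) x := fun j x =>
    (contDiff_partialD (m := 2) (k := 1) hψ (by norm_num) j).differentiable one_ne_zero x
  have h1 : ∀ j, partialDMat j (fun y => Real.exp (-ψ y) • G y) =
      fun y => Real.exp (-ψ y) • (partialDMat j G y - partialD j ψ y • G y) := fun j =>
    funext fun y => partialDMat_exp_smul (hGd y) (hψd y) j
  have h2 : ∀ i j, partialDMat i (fun y => partialDMat j G y - partialD j ψ y • G y) x =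
      partialDMat i (partialDMat j G) x -
        (partialD i (partialD j ψ) x • G x + partialD j ψ x • partialDMat i G x) := by
    intro i j
    ext τ ξ
    change partialD i (fun y => partialDMat j G y τ ξ - partialD j ψ y * G y τ ξ) x =
      partialD i (fun y => partialDMat j G y τ ξ) x - (partialD i (partialD j ψ) x * G x τ ξ +
        partialD j ψ x * partialD i (fun y => G y τ ξ) x)
    rw [partialD_sub (hGd2 j x τ ξ) ((hψd2 j x).fun_mul (hGd x τ ξ)),
      partialD_mul (hψd2 j x) (hGd x τ ξ)]
  have h3 : ∀ i j, partialDMat i (partialDMat j (fun y => Real.exp (-ψ y) • G y)) x =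
      Real.exp (-ψ x) • (partialDMat i (partialDMat j G) x -
        (partialD i (partialD j ψ) x • G x + partialD j ψ x • partialDMat i G x) -
          partialD i ψ x • (partialDMat j G x - partialD j ψ x • G x)) := by
    intro i j
    rw [h1, partialDMat_exp_smul _ (hψd x), h2]
    intro τ ξ
    exact (hGd2 j x τ ξ).fun_sub ((hψd2 j x).fun_mul (hGd x τ ξ))
  have hunit : IsUnit (G x).det := (isUnit_iff_isUnit_det _).1 (hpos x).isUnit
  have he : Real.exp (-ψ x) ≠ 0 := (Real.exp_pos _).ne'
  have h4 : (Real.exp (-ψ x) • G x)⁻¹ = (Real.exp (-ψ x))⁻¹ • (G x)⁻¹ := by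
    refine inv_eq_left_inv ?_
    rw [smul_mul_smul_comm, inv_mul_cancel₀ he, nonsing_inv_mul _ hunit, one_smul]
  have h5 : ∀ i j, partialDMat i (fun y => Real.exp (-ψ y) • G y) x *
      (Real.exp (-ψ x) • G x)⁻¹ * partialDMat j (fun y => Real.exp (-ψ y) • G y) x -
      partialDMat i (partialDMat j (fun y => Real.exp (-ψ y) • G y)) x =
      Real.exp (-ψ x) • (partialDMat i G x * (G x)⁻¹ * partialDMat j G x -
        partialDMat i (partialDMat j G) x + (if i = j then c else 0) • G x) := by
    intro i j
    have h6 : partialD i (partialD j ψ) x = if i = j then c else 0 := by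
      have := congrFun (congrFun hc i) j
      simpa [hessMatrix, one_apply] using this
    rw [h3, h1, h1, h4, ← h6]
    simp only [Matrix.smul_mul, Matrix.mul_smul, smul_smul, Matrix.sub_mul, Matrix.mul_sub,
      nonsing_inv_mul_cancel_right _ _ hunit, Matrix.mul_assoc, mul_nonsing_inv _ hunit,
      Matrix.one_mul]
    simp only [inv_mul_cancel₀ he, one_smul, mul_one]
    module
  unfold bochnerIntegrand
  simp only [h5]
  have h7 : ∀ i, v i x ⬝ᵥ G x *ᵥ v i x =
      ∑ j, (if i = j then v i x ⬝ᵥ G x *ᵥ v j x else 0) := fun i => by simp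
  simp only [h7, Finset.mul_sum, ← Finset.sum_add_distrib]
  refine Finset.sum_congr rfl fun i _ => Finset.sum_congr rfl fun j _ => ?_
  simp only [smul_mulVec, add_mulVec, dotProduct_smul, dotProduct_add, smul_eq_mul]
  split_ifs <;> ring

end weight

/-! ### The weak equation in coordinates -/

/-- The scalar coefficient `α_{I,τ}` of a form as a continuous linear functional. -/
noncomputable def coeffCLM (I : Fin q → Fin n) (τ : Fin r) : Form n r q →L[ℝ] ℝ :=
  (ContinuousLinearMap.proj τ).comp
    (ContinuousAlternatingMap.apply ℝ (Rn n) (Fin r → ℝ) fun k => frame (I k))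

/-- The exterior product with a fixed covector as a continuous linear map. -/
noncomputable def wedgeCLM (ℓ : Rn n →L[ℝ] ℝ) : Form n r p →L[ℝ] Form n r (p + 1) :=
  (ContinuousAlternatingMap.alternatizeUncurryFinCLM ℝ (Rn n) (Fin r → ℝ)).comp
    (ContinuousLinearMap.smulRightL ℝ (Rn n) (Form n r p) ℓ)

lemma wedge_eq_sum (ℓ : Rn n →L[ℝ] ℝ) (β : Form n r p) :
    wedge ℓ β = ∑ i, ℓ (frame i) • wedge (coframe i) β := by
  have h : ℓ = ∑ i, ℓ (frame i) • coframe i := by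
    ext v
    have hv : v = ∑ i, v i • frame i := by
      ext k
      simp [frame_apply]
    conv_lhs => rw [hv, map_sum]
    simp [coframe, mul_comm]
  have h2 : (∑ i, ℓ (frame i) • coframe i).smulRight β =
      ∑ i, ℓ (frame i) • (coframe i).smulRight β := by
    ext v : 1
    simp [Finset.sum_smul, smul_smul]
  conv_lhs => rw [h]
  unfold wedge
  rw [h2, ← ContinuousAlternatingMap.alternatizeUncurryFinCLM_apply, map_sum]
  simp

lemma locallyIntegrableOn_clm {E F : Type*} [NormedAddCommGroup E] [NormedSpace ℝ E]
    [NormedAddCommGroup F] [NormedSpace ℝ F] {D : Set (Rn n)} {u : Rn n → E}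
    (hu : LocallyIntegrableOn u D) (L : E →L[ℝ] F) : LocallyIntegrableOn (fun x => L (u x)) D := by
  intro x hx
  obtain ⟨s, hs, h⟩ := hu x hx
  exact ⟨s, hs, L.integrable_comp h⟩

lemma contDiff_coeff {m : WithTop ℕ∞} {Φ : Rn n → Form n r q} (hΦ : ContDiff ℝ m Φ)
    (I : Fin q → Fin n) (τ : Fin r) : ContDiff ℝ m fun x => coeff (Φ x) I τ :=
  (coeffCLM I τ).contDiff.comp hΦ

lemma tsupport_coeff_subset (Φ : Rn n → Form n r q) (I : Fin q → Fin n) (τ : Fin r) :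
    tsupport (fun x => coeff (Φ x) I τ) ⊆ tsupport Φ := by
  have hsub : Function.support (fun x => coeff (Φ x) I τ) ⊆ Function.support Φ :=
    fun y hy h0 => hy (by simp [h0, coeff_zero])
  exact closure_mono hsub

lemma partialDVec_coeff {Φ : Rn n → Form n r q} {x : Rn n} (hΦ : DifferentiableAt ℝ Φ x)
    (I : Fin q → Fin n) (i : Fin n) :
    partialDVec i (fun y => coeff (Φ y) I) x = coeff (fderiv ℝ Φ x (frame i)) I := by
  ext τ
  have h := ((coeffCLM I τ).hasFDerivAt.comp x hΦ.hasFDerivAt).fderiv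
  have e : (coeffCLM I τ : Form n r q → ℝ) ∘ Φ = fun y => coeff (Φ y) I τ := rfl
  rw [e] at h
  simp only [partialDVec, partialD, h]
  rfl

lemma integrable_sum_of_integrable {ι E : Type*} [Fintype ι] [NormedAddCommGroup E]
    {F : ι → Rn n → E} (hF : ∀ i, Integrable (F i)) : Integrable fun x => ∑ i, F i x :=
  integrable_finsetSum _ fun i _ => hF i

/-- The scalar equations contained in `du = f`. -/
lemma IsWeakExtDeriv.integral_coeff {D : Set (Rn n)} {u : Rn n → Form n r p}
    {f : Rn n → Form n r (p + 1)} (h : IsWeakExtDeriv D u f) (I : Fin (p + 1) → Fin n) (τ : Fin r)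
    {φ : Rn n → ℝ} (hφ : ContDiff ℝ ∞ φ) (hc : HasCompactSupport φ) (hs : tsupport φ ⊆ D) :
    ∫ x in D, φ x * coeff (f x) I τ =
      -∫ x in D, ∑ i, partialD i φ x * coeff (wedge (coframe i) (u x)) I τ := by
  obtain ⟨hu, hf, hw⟩ := h
  have hφ1 : ContDiff ℝ 1 φ := hφ.of_le (by exact_mod_cast le_top)
  have h1 : Integrable fun x => φ x • f x :=
    integrable_smul_of_locallyIntegrableOn hf hφ.continuous hc hs
  have hw' : ∀ x, wedge (fderiv ℝ φ x) (u x) =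
      ∑ i, partialD i φ x • wedgeCLM (coframe i) (u x) := fun x => wedge_eq_sum _ _
  have hw := hw φ hφ hc hs
  simp only [hw'] at hw
  have h2i : ∀ i, Integrable fun x => partialD i φ x • wedgeCLM (coframe i) (u x) := by
    intro i
    have l := locallyIntegrableOn_clm hu (wedgeCLM (coframe i))
    have c1 := continuous_partialD hφ1 i
    have c2 := hasCompactSupport_partialD hc i
    have c3 := (tsupport_partialD_subset φ i).trans hs
    exact integrable_smul_of_locallyIntegrableOn l c1 c2 c3
  have h2 := integrable_sum_of_integrable h2i
  have h3 := congrArg (coeffCLM I τ) hw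
  rw [map_neg, ← ContinuousLinearMap.integral_comp_comm _ h1.integrableOn,
    ← ContinuousLinearMap.integral_comp_comm _ h2.integrableOn] at h3
  have e1 : ∀ x, coeffCLM I τ (φ x • f x) = φ x * coeff (f x) I τ := fun x => map_smul _ _ _
  have e2 : ∀ x, coeffCLM I τ (∑ i, partialD i φ x • wedgeCLM (coframe i) (u x)) =
      ∑ i, partialD i φ x * coeff (wedge (coframe i) (u x)) I τ := fun x => by
    rw [map_sum]
    exact Finset.sum_congr rfl fun i _ => map_smul _ _ _
  simp only [e1, e2] at h3
  exact h3

lemma sum_coeff_wedge_fderiv (Φ : Rn n → Form n r (p + 1)) (β : Form n r p) (x : Rn n) :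
    ∑ i, ∑ I, coeff (wedge (coframe i) β) I ⬝ᵥ coeff (fderiv ℝ Φ x (frame i)) I =
      ((p : ℝ) + 1) * ∑ J, coeff β J ⬝ᵥ ∑ i, coeff (fderiv ℝ Φ x (frame i)) (Fin.cons i J) := by
  simp_rw [sum_coeff_wedge_dotProduct, ← Finset.mul_sum, dotProduct_sum]
  rw [Finset.sum_comm]

/-- The weak equation `du = f` tested against a `C¹` form. -/
lemma IsWeakExtDeriv.integral_dotProduct {D : Set (Rn n)} (hD : IsOpen D) {u : Rn n → Form n r p}
    {f : Rn n → Form n r (p + 1)} (h : IsWeakExtDeriv D u f) {Φ : Rn n → Form n r (p + 1)}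
    (hΦ : ContDiff ℝ 1 Φ) (hc : HasCompactSupport Φ) (hs : tsupport Φ ⊆ D) :
    IntegrableOn (fun x => ∑ J, coeff (u x) J ⬝ᵥ
      ∑ i, coeff (fderiv ℝ Φ x (frame i)) (Fin.cons i J)) D ∧
    ∫ x in D, ∑ I, coeff (f x) I ⬝ᵥ coeff (Φ x) I = -(((p : ℝ) + 1) *
      ∫ x in D, ∑ J, coeff (u x) J ⬝ᵥ
        ∑ i, coeff (fderiv ℝ Φ x (frame i)) (Fin.cons i J)) := by
  have hcc : ∀ I τ, HasCompactSupport fun x => coeff (Φ x) I τ := fun I τ =>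
    HasCompactSupport.of_support_subset_isCompact hc
      ((subset_tsupport _).trans (tsupport_coeff_subset Φ I τ))
  have hcs : ∀ I τ, tsupport (fun x => coeff (Φ x) I τ) ⊆ D := fun I τ =>
    (tsupport_coeff_subset Φ I τ).trans hs
  have hcd : ∀ I τ, ContDiff ℝ 1 fun x => coeff (Φ x) I τ := contDiff_coeff hΦ
  have hfl : ∀ I τ, LocallyIntegrableOn (fun x => coeff (f x) I τ) D := fun I τ =>
    locallyIntegrableOn_clm h.2.1 (coeffCLM I τ)
  have hul : ∀ i I τ, LocallyIntegrableOn (fun x => coeff (wedge (coframe i) (u x)) I τ) D :=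
    fun i I τ => locallyIntegrableOn_clm h.1 ((coeffCLM I τ).comp (wedgeCLM (coframe i)))
  have hfi : ∀ I τ, IntegrableOn (fun x => coeff (Φ x) I τ * coeff (f x) I τ) D := fun I τ =>
    (integrable_mul_of_locallyIntegrableOn (hfl I τ) (hcd I τ).continuous (hcc I τ)
      (hcs I τ)).integrableOn
  have hui : ∀ i I τ, IntegrableOn (fun x => partialD i (fun y => coeff (Φ y) I τ) x *
      coeff (wedge (coframe i) (u x)) I τ) D := fun i I τ =>
    (integrable_mul_of_locallyIntegrableOn (hul i I τ) (continuous_partialD (hcd I τ) i)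
      (hasCompactSupport_partialD (hcc I τ) i)
      ((tsupport_partialD_subset _ i).trans (hcs I τ))).integrableOn
  have hui' : ∀ I τ, IntegrableOn (fun x => ∑ i, partialD i (fun y => coeff (Φ y) I τ) x *
      coeff (wedge (coframe i) (u x)) I τ) D := fun I τ =>
    integrable_finsetSum _ fun i _ => hui i I τ
  have hmain : ∀ I τ, ∫ x in D, coeff (Φ x) I τ * coeff (f x) I τ =
      -∫ x in D, ∑ i, partialD i (fun y => coeff (Φ y) I τ) x *
        coeff (wedge (coframe i) (u x)) I τ := fun I τ =>
    integral_mul_eq_of_contDiff_one hD (hfl I τ) (fun i => hul i I τ)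
      (fun φ hφ hφc hφs => h.integral_coeff I τ hφ hφc hφs) (hcd I τ) (hcc I τ) (hcs I τ)
  have e1 : ∀ x, ∑ I, coeff (f x) I ⬝ᵥ coeff (Φ x) I =
      ∑ I, ∑ τ, coeff (Φ x) I τ * coeff (f x) I τ := fun x => by
    simp only [dotProduct, mul_comm]
  have e2 : ∀ x, ∑ I, ∑ τ, ∑ i, partialD i (fun y => coeff (Φ y) I τ) x *
      coeff (wedge (coframe i) (u x)) I τ = ((p : ℝ) + 1) * ∑ J, coeff (u x) J ⬝ᵥ
        ∑ i, coeff (fderiv ℝ Φ x (frame i)) (Fin.cons i J) := by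
    intro x
    rw [← sum_coeff_wedge_fderiv, Finset.sum_comm]
    simp_rw [Finset.sum_comm (t := (Finset.univ : Finset (Fin n)))]
    refine Finset.sum_congr rfl fun i _ => ?_
    rw [Finset.sum_comm]
    refine Finset.sum_congr rfl fun I _ => Finset.sum_congr rfl fun τ _ => ?_
    have := congrFun (partialDVec_coeff (hΦ.differentiable one_ne_zero x) I i) τ
    rw [partialDVec] at this
    rw [this, mul_comm]
  have hp : ((p : ℝ) + 1) ≠ 0 := by positivity
  have hi : IntegrableOn (fun x => ∑ I, ∑ τ, ∑ i, partialD i (fun y => coeff (Φ y) I τ) x *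
      coeff (wedge (coframe i) (u x)) I τ) D :=
    integrable_finsetSum _ fun I _ => integrable_finsetSum _ fun τ _ => hui' I τ
  constructor
  · simp_rw [e2] at hi
    have := hi.const_mul ((p : ℝ) + 1)⁻¹
    simp only [inv_mul_cancel_left₀ hp] at this
    exact this
  · rw [← integral_const_mul]
    simp_rw [e1, ← e2]
    rw [integral_finsetSum _ fun I _ => integrable_finsetSum _ fun τ _ => hfi I τ,
      integral_finsetSum _ fun I _ => integrable_finsetSum _ fun τ _ => hui' I τ,
      ← Finset.sum_neg_distrib]
    refine Finset.sum_congr rfl fun I _ => ?_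
    rw [integral_finsetSum _ fun τ _ => hfi I τ, integral_finsetSum _ fun τ _ => hui' I τ,
      ← Finset.sum_neg_distrib]
    exact Finset.sum_congr rfl fun τ _ => hmain I τ

lemma contDiff_actFibre {m : WithTop ℕ∞} {H : Rn n → Matrix (Fin r) (Fin r) ℝ}
    {f : Rn n → Form n r q} (hH : ∀ τ ξ, ContDiff ℝ m fun y => H y τ ξ) (hf : ContDiff ℝ m f) :
    ContDiff ℝ m fun x => actFibre (H x) (f x) := by
  let L : Fin r → Fin r → Form n r q →L[ℝ] Form n r q := fun τ ξ =>
    ContinuousLinearMap.compContinuousAlternatingMapCLM ℝ (Rn n) (Fin r → ℝ) (Fin r → ℝ) (Fin q)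
      (LinearMap.toContinuousLinearMap (Matrix.single τ ξ (1 : ℝ)).mulVecLin)
  have h : ∀ x, actFibre (H x) (f x) = ∑ τ, ∑ ξ, H x τ ξ • L τ ξ (f x) := by
    intro x
    conv_lhs => rw [matrix_eq_sum_single (H x)]
    ext v k
    simp [actFibre, L, ContinuousAlternatingMap.sum_apply, Finset.sum_apply,
      mulVec, dotProduct, single_apply, Finset.mul_sum]
  simp_rw [h]
  exact ContDiff.sum fun τ _ => ContDiff.sum fun ξ _ => (hH τ ξ).smul ((L τ ξ).contDiff.comp hf)

/-! ### The curvature inequality -/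

/-- The vector fields `x ↦ (f_{iJ}(x))_i` of coefficients of a form, for a multi-index `J`. -/
noncomputable def contractField (f : Rn n → Form n r (p + 1)) (J : Fin p → Fin n) (i : Fin n)
    (x : Rn n) : Fin r → ℝ :=
  coeff (f x) (Fin.cons i J)

lemma tsupport_contractField_subset (f : Rn n → Form n r (p + 1)) (J : Fin p → Fin n)
    (i : Fin n) : tsupport (contractField f J i) ⊆ tsupport f := by
  have hsub : Function.support (contractField f J i) ⊆ Function.support f :=
    fun y hy h0 => hy (by simp [contractField, h0, coeff_zero])
  exact closure_mono hsub

lemma sum_dotProduct_contractField (M : Matrix (Fin r) (Fin r) ℝ) (f : Rn n → Form n r (p + 1))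
    (x : Rn n) : ∑ I, coeff (f x) I ⬝ᵥ M *ᵥ coeff (f x) I =
      ∑ J, ∑ i, contractField f J i x ⬝ᵥ M *ᵥ contractField f J i x := by
  rw [← (Fin.consEquiv (fun _ : Fin (p + 1) => Fin n)).sum_comp, Fintype.sum_prod_type,
    Finset.sum_comm]
  rfl

lemma sum_coeff_fderiv_actFibre {H : Rn n → Matrix (Fin r) (Fin r) ℝ}
    {f : Rn n → Form n r (p + 1)} (hH : ∀ τ ξ, ContDiff ℝ 2 fun y => H y τ ξ)
    (hf : ContDiff ℝ 2 f) (J : Fin p → Fin n) (x : Rn n) :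
    ∑ i, coeff (fderiv ℝ (fun y => actFibre (H y) (f y)) x (frame i)) (Fin.cons i J) =
      metricDiv H (contractField f J) x := by
  unfold metricDiv
  refine Finset.sum_congr rfl fun i _ => ?_
  rw [← partialDVec_coeff ((contDiff_actFibre hH hf).differentiable two_ne_zero x)]
  rfl

/-- A weighted arithmetic-geometric mean inequality for a positive definite form. -/
lemma neg_two_mul_dotProduct_le {H : Matrix (Fin r) (Fin r) ℝ} (hH : H.PosDef) {t : ℝ}
    (ht : 0 < t) (u y : Fin r → ℝ) :
    -(2 * (u ⬝ᵥ y)) ≤ t * (u ⬝ᵥ H *ᵥ u) + t⁻¹ * (y ⬝ᵥ H⁻¹ *ᵥ y) := by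
  have hsymm : Hᵀ = H := by
    simpa [conjTranspose_eq_transpose_of_trivial] using hH.isHermitian.eq
  have hunit : IsUnit H.det := (isUnit_iff_isUnit_det _).1 hH.isUnit
  have h := hH.posSemidef.dotProduct_mulVec_nonneg (t • u + H⁻¹ *ᵥ y)
  have e1 : H *ᵥ (H⁻¹ *ᵥ y) = y := by
    rw [mulVec_mulVec, mul_nonsing_inv _ hunit, one_mulVec]
  have e2 : (H⁻¹ *ᵥ y) ⬝ᵥ H *ᵥ u = u ⬝ᵥ y := by
    rw [dotProduct_mulVec, ← mulVec_transpose, hsymm, e1, dotProduct_comm]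
  simp only [star_trivial, mulVec_add, mulVec_smul, e1, add_dotProduct, dotProduct_add,
    smul_dotProduct, dotProduct_smul, smul_eq_mul, e2] at h
  rw [dotProduct_comm (H⁻¹ *ᵥ y) y] at h
  have h2 : 0 ≤ t⁻¹ * (t * (t * (u ⬝ᵥ H *ᵥ u)) + t * (u ⬝ᵥ y) +
      (t * (u ⬝ᵥ y) + y ⬝ᵥ H⁻¹ *ᵥ y)) := mul_nonneg (inv_nonneg.2 ht.le) (by linarith)
  have h3 : t⁻¹ * (t * (t * (u ⬝ᵥ H *ᵥ u)) + t * (u ⬝ᵥ y) +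
      (t * (u ⬝ᵥ y) + y ⬝ᵥ H⁻¹ *ᵥ y)) =
      t * (u ⬝ᵥ H *ᵥ u) + 2 * (u ⬝ᵥ y) + t⁻¹ * (y ⬝ᵥ H⁻¹ *ᵥ y) := by
    field_simp
    ring
  linarith

section energy

lemma two_le_infty : (2 : WithTop ℕ∞) ≤ ∞ :=
  WithTop.coe_le_coe.2 (le_top : (2 : ℕ∞) ≤ ⊤)

variable {D U : Set (Rn n)} {g G : Rn n → Matrix (Fin r) (Fin r) ℝ} {ψ : Rn n → ℝ}
  {f : Rn n → Form n r (p + 1)} {c : ℝ}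

lemma contDiff_exp_smul {m : WithTop ℕ∞} (hG : ∀ τ ξ, ContDiff ℝ m fun y => G y τ ξ)
    (hψ : ContDiff ℝ m ψ) (τ ξ : Fin r) :
    ContDiff ℝ m fun y => (Real.exp (-ψ y) • G y) τ ξ := by
  change ContDiff ℝ m fun y => Real.exp (-ψ y) * G y τ ξ
  exact hψ.neg.exp.mul (hG τ ξ)

/-- The `L²` estimate tested against the form `f` itself. Up to a common factor it says
`c q ‖f‖² ≤ ‖d^* f‖²`, where `q` is the degree of `f` and `d^*` is the adjoint of `d` in the
weighted metric. The metric `G` replaces `g` by a globally defined one which agrees with `g` on a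
neighbourhood `U` of the support of `f`. -/
lemma mul_integral_le_integral_metricDiv (hD : IsOpen D) (hg : ∀ x ∈ D, (g x).PosDef)
    (hG : ∀ τ ξ, ContDiff ℝ 2 fun y => G y τ ξ) (hGpos : ∀ x, (G x).PosDef)
    (hf : IsCompactlySupportedForm D f) (hfd : ∀ x ∈ D, extDeriv f x = 0)
    (hfU : tsupport f ⊆ U) (hGg : ∀ x ∈ U, G x = g x) (hψ : ContDiff ℝ ∞ ψ) (hc : 0 < c)
    (hess : ∀ x, hessMatrix ψ x = c • 1) (hL : L2Solvable p D g ψ) :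
    c * ∫ x, Real.exp (-ψ x) * ∑ I, coeff (f x) I ⬝ᵥ G x *ᵥ coeff (f x) I ≤
      ∫ x, ∑ J, metricDiv (fun y => Real.exp (-ψ y) • G y) (contractField f J) x ⬝ᵥ
        (Real.exp (-ψ x) • G x)⁻¹ *ᵥ
          metricDiv (fun y => Real.exp (-ψ y) • G y) (contractField f J) x := by
  set H : Rn n → Matrix (Fin r) (Fin r) ℝ := fun y => Real.exp (-ψ y) • G y with hHdef
  have hψ2 : ContDiff ℝ 2 ψ := hψ.of_le two_le_infty
  have hf2 : ContDiff ℝ 2 f := hf.contDiff.of_le two_le_infty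
  have hH : ∀ τ ξ, ContDiff ℝ 2 fun y => H y τ ξ := contDiff_exp_smul hG hψ2
  have hHpos : ∀ x, (H x).PosDef := fun x => (hGpos x).smul (Real.exp_pos _)
  have hf0 : ∀ x, x ∉ U → f x = 0 := fun x hx =>
    image_eq_zero_of_notMem_tsupport fun h => hx (hfU h)
  have hv2 : ∀ J i τ, ContDiff ℝ 2 fun y => contractField f J i y τ := fun J i τ =>
    contDiff_coeff hf2 _ τ
  set A : ℝ := ∫ x, Real.exp (-ψ x) * ∑ I, coeff (f x) I ⬝ᵥ G x *ᵥ coeff (f x) I with hA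
  set y : (Fin p → Fin n) → Rn n → Fin r → ℝ := fun J => metricDiv H (contractField f J) with hy
  have hy0 : ∀ J x, x ∉ tsupport f → y J x = 0 := fun J x hx =>
    metricDiv_eq_zero fun i h => hx (tsupport_contractField_subset f J i h)
  have hVi : Integrable fun x => ∑ J, y J x ⬝ᵥ (H x)⁻¹ *ᵥ y J x :=
    integrable_finsetSum _ fun J _ => integrable_metricDiv hH (hv2 J) hHpos
      hf.hasCompactSupport.isCompact (tsupport_contractField_subset f J)
  set V : ℝ := ∫ x, ∑ J, y J x ⬝ᵥ (H x)⁻¹ *ᵥ y J x with hV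
  -- The right-hand side of the `L²` estimate is `k * A`, as `Hess_ψ` is the scalar `c * (p + 1)`.
  set k : ℝ := (c * ((p : ℝ) + 1))⁻¹ * ((p + 1).factorial : ℝ)⁻¹ with hk
  have hR : ∀ x, formInner (g x) (hessOpInv ψ x (f x)) (f x) * Real.exp (-ψ x) =
      k * (Real.exp (-ψ x) * ∑ I, coeff (f x) I ⬝ᵥ G x *ᵥ coeff (f x) I) := by
    intro x
    rw [hessOpInv_of_hessMatrix hc.ne' (hess x), formInner_eq_sum]
    by_cases hx : x ∈ U
    · rw [← hGg x hx]
      simp only [coeff_smul, smul_dotProduct, smul_eq_mul, ← Finset.mul_sum]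
      ring
    · simp [hf0 x hx, coeff_zero]
  have hcoeff : ∀ I, Continuous fun x => coeff (f x) I := fun I =>
    continuous_pi fun τ => (contDiff_coeff hf2 I τ).continuous
  have hGc : Continuous G := continuous_matrix fun τ ξ => (hG τ ξ).continuous
  have hRi : Integrable fun x => Real.exp (-ψ x) * ∑ I, coeff (f x) I ⬝ᵥ G x *ᵥ coeff (f x) I := by
    refine Continuous.integrable_of_hasCompactSupport ?_ ?_
    · exact (Real.continuous_exp.comp hψ.continuous.neg).mul (continuous_finsetSum _ fun I _ =>
        (hcoeff I).dotProduct (hGc.matrix_mulVec (hcoeff I)))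
    · refine HasCompactSupport.intro hf.hasCompactSupport fun x hx => ?_
      simp [image_eq_zero_of_notMem_tsupport hx, coeff_zero]
  have hRA : ∫ x in D, Real.exp (-ψ x) * ∑ I, coeff (f x) I ⬝ᵥ G x *ᵥ coeff (f x) I = A := by
    refine setIntegral_eq_integral_of_forall_compl_eq_zero fun x hx => ?_
    simp [image_eq_zero_of_notMem_tsupport fun h => hx (hf.tsupport_subset h), coeff_zero]
  obtain ⟨u, hw, hui, hule⟩ := hL f hf hfd (by
    simp_rw [hR]
    exact (hRi.const_mul k).integrableOn)
  simp_rw [hR, integral_const_mul, hRA] at hule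
  have hS : ∀ x, formInner (g x) (u x) (u x) * Real.exp (-ψ x) = (p.factorial : ℝ)⁻¹ *
      ∑ J, coeff (u x) J ⬝ᵥ (Real.exp (-ψ x) • g x) *ᵥ coeff (u x) J := by
    intro x
    rw [formInner_eq_sum]
    simp only [smul_mulVec, dotProduct_smul, smul_eq_mul, ← Finset.mul_sum]
    ring
  have hpf : (p.factorial : ℝ) ≠ 0 := by positivity
  have hSi : IntegrableOn (fun x => ∑ J, coeff (u x) J ⬝ᵥ (Real.exp (-ψ x) • g x) *ᵥ
      coeff (u x) J) D := by
    have := hui.const_mul (p.factorial : ℝ)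
    simp only [hS, mul_inv_cancel_left₀ hpf] at this
    exact this
  simp_rw [hS, integral_const_mul] at hule
  set S : ℝ := ∫ x in D, ∑ J, coeff (u x) J ⬝ᵥ (Real.exp (-ψ x) • g x) *ᵥ coeff (u x) J with hSdef
  have hSA : c * ((p : ℝ) + 1) ^ 2 * S ≤ A := by
    have h1 : S ≤ p.factorial * (k * A) := by
      rwa [inv_mul_le_iff₀ (by positivity)] at hule
    have h2 : (p.factorial : ℝ) * (k * A) = (c * ((p : ℝ) + 1) ^ 2)⁻¹ * A := by
      rw [hk, Nat.factorial_succ]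
      push_cast
      field_simp
    rw [h2, le_inv_mul_iff₀ (by positivity)] at h1
    exact h1
  -- The weak equation tested against `e^{-ψ} G f`.
  have hΦs : tsupport (fun x => actFibre (H x) (f x)) ⊆ tsupport f := by
    have hsub : Function.support (fun x => actFibre (H x) (f x)) ⊆ Function.support f := by
      intro x hx h0
      refine hx ?_
      ext v τ
      simp [actFibre, h0]
    exact closure_mono hsub
  obtain ⟨hTi, hT⟩ := hw.integral_dotProduct hD
    ((contDiff_actFibre hH hf2).of_le one_le_two)
    (HasCompactSupport.of_support_subset_isCompact hf.hasCompactSupport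
      ((subset_tsupport _).trans hΦs)) (hΦs.trans hf.tsupport_subset)
  simp only [sum_coeff_fderiv_actFibre hH hf2, coeff_actFibre] at hTi hT
  have hTA : ∫ x in D, ∑ I, coeff (f x) I ⬝ᵥ H x *ᵥ coeff (f x) I = A := by
    rw [← hRA]
    refine integral_congr_ae (Eventually.of_forall fun x => ?_)
    simp only [hHdef, smul_mulVec, dotProduct_smul, smul_eq_mul, ← Finset.mul_sum]
  rw [hTA] at hT
  -- The parameter `t` is chosen such that the term with `u` absorbs half of `A`, by `hSA`.
  set t : ℝ := c * ((p : ℝ) + 1) with ht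
  have htpos : 0 < t := by positivity
  have hpt : ∀ x ∈ D, -(2 * ∑ J, coeff (u x) J ⬝ᵥ y J x) ≤
      t * ∑ J, coeff (u x) J ⬝ᵥ (Real.exp (-ψ x) • g x) *ᵥ coeff (u x) J +
        t⁻¹ * ∑ J, y J x ⬝ᵥ (H x)⁻¹ *ᵥ y J x := by
    intro x hx
    simp only [Finset.mul_sum, ← Finset.sum_neg_distrib, ← Finset.sum_add_distrib]
    refine Finset.sum_le_sum fun J _ => ?_
    by_cases hxU : x ∈ U
    · rw [← hGg x hxU]
      exact neg_two_mul_dotProduct_le (hHpos x) htpos _ _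
    · rw [hy0 J x fun h => hxU (hfU h)]
      have h := ((hg x hx).smul (Real.exp_pos (-ψ x))).posSemidef.dotProduct_mulVec_nonneg
        (coeff (u x) J)
      rw [star_trivial] at h
      simpa using mul_nonneg htpos.le h
  have hint : ∫ x in D, -(2 * ∑ J, coeff (u x) J ⬝ᵥ y J x) ≤
      ∫ x in D, (t * ∑ J, coeff (u x) J ⬝ᵥ (Real.exp (-ψ x) • g x) *ᵥ coeff (u x) J +
        t⁻¹ * ∑ J, y J x ⬝ᵥ (H x)⁻¹ *ᵥ y J x) :=
    setIntegral_mono_on (hTi.const_mul 2).neg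
      ((hSi.const_mul t).add (hVi.integrableOn.const_mul t⁻¹)) hD.measurableSet hpt
  have hVD : ∫ x in D, ∑ J, y J x ⬝ᵥ (H x)⁻¹ *ᵥ y J x = V := by
    refine setIntegral_eq_integral_of_forall_compl_eq_zero fun x hx => ?_
    refine Finset.sum_eq_zero fun J _ => ?_
    simp [hy0 J x fun h => hx (hf.tsupport_subset h)]
  rw [integral_neg, integral_const_mul, integral_add (hSi.const_mul t)
    (hVi.integrableOn.const_mul t⁻¹), integral_const_mul, integral_const_mul, hVD, ← hSdef] at hint
  set T : ℝ := ∫ x in D, ∑ J, coeff (u x) J ⬝ᵥ y J x with hTdef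
  have h1 : 2 * A ≤ ((p : ℝ) + 1) * (t * S + t⁻¹ * V) := by
    rw [hT]
    have hp : (0 : ℝ) ≤ (p : ℝ) + 1 := by positivity
    nlinarith [mul_le_mul_of_nonneg_left hint hp]
  have h2 : ((p : ℝ) + 1) * (t * S + t⁻¹ * V) = c * ((p : ℝ) + 1) ^ 2 * S + c⁻¹ * V := by
    rw [ht]
    field_simp
  have h3 : A ≤ c⁻¹ * V := by linarith
  rwa [le_inv_mul_iff₀ hc] at h3

/-- Combination of the `L²` estimate with the Bochner formula: the curvature of the weight cancels
against the constant of the estimate. -/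
lemma integral_bochnerIntegrand_nonneg (hD : IsOpen D) (hg : ∀ x ∈ D, (g x).PosDef)
    (hG : ∀ τ ξ, ContDiff ℝ 2 fun y => G y τ ξ) (hGpos : ∀ x, (G x).PosDef)
    (hf : IsCompactlySupportedForm D f) (hfd : ∀ x ∈ D, extDeriv f x = 0)
    (hfU : tsupport f ⊆ U) (hGg : ∀ x ∈ U, G x = g x) (hψ : ContDiff ℝ ∞ ψ) (hc : 0 < c)
    (hess : ∀ x, hessMatrix ψ x = c • 1) (hL : L2Solvable p D g ψ) :
    0 ≤ ∫ x, Real.exp (-ψ x) * ∑ J, bochnerIntegrand G (contractField f J) x := by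
  have h := mul_integral_le_integral_metricDiv hD hg hG hGpos hf hfd hfU hGg hψ hc hess hL
  have hψ2 : ContDiff ℝ 2 ψ := hψ.of_le two_le_infty
  have hf2 : ContDiff ℝ 2 f := hf.contDiff.of_le two_le_infty
  have hH := contDiff_exp_smul hG hψ2
  have hHpos : ∀ x, (Real.exp (-ψ x) • G x).PosDef := fun x => (hGpos x).smul (Real.exp_pos _)
  have hv2 : ∀ J i τ, ContDiff ℝ 2 fun y => contractField f J i y τ := fun J i τ =>
    contDiff_coeff hf2 _ τ
  have hK := hf.hasCompactSupport.isCompact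
  have hsupp := tsupport_contractField_subset f
  have hexp : Continuous fun x => Real.exp (-ψ x) := Real.continuous_exp.comp hψ.continuous.neg
  have hcoeff : ∀ I, Continuous fun x => coeff (f x) I := fun I =>
    continuous_pi fun τ => (contDiff_coeff hf2 I τ).continuous
  have hGc : Continuous G := continuous_matrix fun τ ξ => (hG τ ξ).continuous
  have i1 : Integrable fun x =>
      Real.exp (-ψ x) * ∑ J, bochnerIntegrand G (contractField f J) x := by
    refine (hexp.mul (continuous_finsetSum _ fun J _ =>
      continuous_bochnerIntegrand hG (hv2 J) hGpos)).integrable_of_hasCompactSupport ?_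
    refine HasCompactSupport.intro hK fun x hx => ?_
    have h0 : ∀ J, bochnerIntegrand G (contractField f J) x = 0 := fun J =>
      bochnerIntegrand_eq_zero fun i h => hx (hsupp J i h)
    simp [h0]
  have i2 : Integrable fun x => Real.exp (-ψ x) * ∑ I, coeff (f x) I ⬝ᵥ G x *ᵥ coeff (f x) I := by
    refine (hexp.mul (continuous_finsetSum _ fun I _ =>
      (hcoeff I).dotProduct (hGc.matrix_mulVec (hcoeff I)))).integrable_of_hasCompactSupport ?_
    refine HasCompactSupport.intro hK fun x hx => ?_
    simp [image_eq_zero_of_notMem_tsupport hx, coeff_zero]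
  rw [integral_finsetSum _ fun J _ => integrable_metricDiv hH (hv2 J) hHpos hK (hsupp J),
    Finset.sum_congr rfl fun J _ => integral_metricDiv hH (hv2 J) hHpos hK (hsupp J),
    ← integral_finsetSum _ fun J _ => (continuous_bochnerIntegrand hH (hv2 J)
      hHpos).integrable_of_hasCompactSupport (hasCompactSupport_bochnerIntegrand hK (hsupp J))] at h
  have e : ∀ x, ∑ J, bochnerIntegrand (fun y => Real.exp (-ψ y) • G y) (contractField f J) x =
      Real.exp (-ψ x) * ∑ J, bochnerIntegrand G (contractField f J) x +
        c * (Real.exp (-ψ x) * ∑ I, coeff (f x) I ⬝ᵥ G x *ᵥ coeff (f x) I) := by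
    intro x
    rw [sum_dotProduct_contractField]
    simp only [bochnerIntegrand_exp_smul hG hGpos hψ2 (hess x), mul_add, Finset.sum_add_distrib,
      Finset.mul_sum]
    congr 1
    refine Finset.sum_congr rfl fun J _ => Finset.sum_congr rfl fun i _ => ?_
    ring
  simp_rw [e] at h
  rw [integral_add i1 (i2.const_mul c), integral_const_mul] at h
  linarith

end energy

/-! ### Localization at a point -/

lemma partialDMat_congr {A B : Rn n → Matrix (Fin r) (Fin r) ℝ} {x : Rn n} (h : A =ᶠ[𝓝 x] B)
    (i : Fin n) : partialDMat i A x = partialDMat i B x := by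
  ext τ ξ
  exact partialD_congr (h.mono fun y hy => by simp [hy]) i

lemma eventuallyEq_partialDMat {A B : Rn n → Matrix (Fin r) (Fin r) ℝ} {x : Rn n}
    (h : A =ᶠ[𝓝 x] B) (i : Fin n) : partialDMat i A =ᶠ[𝓝 x] partialDMat i B :=
  h.eventuallyEq_nhds.mono fun _ hy => partialDMat_congr hy i

lemma partialDMat_mul {A B : Rn n → Matrix (Fin r) (Fin r) ℝ} {x : Rn n}
    (hA : ∀ τ ξ, DifferentiableAt ℝ (fun y => A y τ ξ) x)
    (hB : ∀ τ ξ, DifferentiableAt ℝ (fun y => B y τ ξ) x) (i : Fin n) :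
    partialDMat i (fun y => A y * B y) x = partialDMat i A x * B x + A x * partialDMat i B x := by
  ext τ ξ
  simp only [partialDMat, of_apply, Matrix.add_apply, Matrix.mul_apply]
  rw [partialD_sum fun k _ => (hA τ k).fun_mul (hB k ξ), ← Finset.sum_add_distrib]
  exact Finset.sum_congr rfl fun k _ => partialD_mul (hA τ k) (hB k ξ) i

lemma contDiff_det {m : WithTop ℕ∞} {A : Rn n → Matrix (Fin r) (Fin r) ℝ}
    (hA : ∀ τ ξ, ContDiff ℝ m fun y => A y τ ξ) : ContDiff ℝ m fun y => (A y).det := by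
  simp only [det_apply]
  exact ContDiff.sum fun σ _ => (contDiff_prod fun k _ => hA _ _).const_smul _

lemma contDiff_matrix_inv {m : WithTop ℕ∞} {A : Rn n → Matrix (Fin r) (Fin r) ℝ}
    (hA : ∀ τ ξ, ContDiff ℝ m fun y => A y τ ξ) (hpos : ∀ x, (A x).PosDef) (τ ξ : Fin r) :
    ContDiff ℝ m fun y => (A y)⁻¹ τ ξ := by
  have h : ∀ y, (A y)⁻¹ τ ξ = ((A y).det)⁻¹ * ((A y).updateRow ξ (Pi.single τ 1)).det := by
    intro y
    rw [inv_def, Ring.inverse_eq_inv, Matrix.smul_apply, adjugate_apply, smul_eq_mul]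
  simp_rw [h]
  refine ((contDiff_det hA).inv fun x => (hpos x).det_pos.ne').mul
    (contDiff_det fun τ' ξ' => ?_)
  by_cases hτ : τ' = ξ
  · subst hτ
    simp only [updateRow_self]
    exact contDiff_const
  · simp only [updateRow_apply, hτ, if_false]
    exact hA τ' ξ'

/-- The curvature matrices, with the metric multiplied in from the left. -/
lemma mul_partialDMat_inv_mul {G : Rn n → Matrix (Fin r) (Fin r) ℝ}
    (hG : ∀ τ ξ, ContDiff ℝ 2 fun y => G y τ ξ) (hpos : ∀ x, (G x).PosDef) (i j : Fin n)
    (x : Rn n) : G x * partialDMat i (fun y => (G y)⁻¹ * partialDMat j G y) x =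
      partialDMat i (partialDMat j G) x - partialDMat i G x * (G x)⁻¹ * partialDMat j G x := by
  have hunit : ∀ y, IsUnit (G y).det := fun y => (isUnit_iff_isUnit_det _).1 (hpos y).isUnit
  have hGd : ∀ τ ξ, Differentiable ℝ fun y => G y τ ξ := fun τ ξ =>
    (hG τ ξ).differentiable two_ne_zero
  have hGd2 : ∀ τ ξ, Differentiable ℝ fun y => partialDMat j G y τ ξ := fun τ ξ =>
    (contDiff_partialD (m := 2) (k := 1) (hG τ ξ) (by norm_num) j).differentiable one_ne_zero
  have hM : ∀ τ ξ, Differentiable ℝ fun y => ((G y)⁻¹ * partialDMat j G y) τ ξ := by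
    intro τ ξ
    simp only [Matrix.mul_apply]
    exact Differentiable.fun_sum fun k _ =>
      ((contDiff_matrix_inv hG hpos τ k).differentiable two_ne_zero).fun_mul (hGd2 k ξ)
  have h := partialDMat_mul (x := x) (fun τ ξ => hGd τ ξ x) (fun τ ξ => hM τ ξ x) i
  have e : (fun y => G y * ((G y)⁻¹ * partialDMat j G y)) = partialDMat j G := by
    ext1 y
    rw [← Matrix.mul_assoc, mul_nonsing_inv _ (hunit y), Matrix.one_mul]
  rw [e, ← Matrix.mul_assoc] at h
  rw [h, add_sub_cancel_left]

/-- At a point near which the form is constant, the integrand of the Bochner formula is the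
curvature form. -/
lemma sum_bochnerIntegrand_eq_formInner {g G : Rn n → Matrix (Fin r) (Fin r) ℝ} {x : Rn n}
    (hG : ∀ τ ξ, ContDiff ℝ 2 fun y => G y τ ξ) (hpos : ∀ x, (G x).PosDef) (hgG : g =ᶠ[𝓝 x] G)
    {f : Rn n → Form n r (p + 1)} {α : Form n r (p + 1)} (hf : f =ᶠ[𝓝 x] fun _ => α) :
    ∑ J, bochnerIntegrand G (contractField f J) x =
      p.factorial * formInner (g x) (curvatureOp g x α) α := by
  have hd : ∀ J i j, partialDVec i (contractField f J j) x = 0 := by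
    intro J i j
    ext τ
    have : (fun y => contractField f J j y τ) =ᶠ[𝓝 x] fun _ => coeff α (Fin.cons j J) τ :=
      hf.mono fun y hy => by simp [contractField, hy]
    rw [partialDVec, partialD_congr this]
    simp [partialD]
  have hsymm : (g x)ᵀ = g x := by
    rw [hgG.eq_of_nhds]
    simpa [conjTranspose_eq_transpose_of_trivial] using (hpos x).isHermitian.eq
  have hA : ∀ i j, g x * partialDMat i (fun y => (g y)⁻¹ * partialDMat j g y) x =
      partialDMat i (partialDMat j G) x - partialDMat i G x * (G x)⁻¹ * partialDMat j G x := by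
    intro i j
    rw [← mul_partialDMat_inv_mul hG hpos, hgG.eq_of_nhds]
    congr 1
    refine partialDMat_congr ?_ i
    filter_upwards [hgG, eventuallyEq_partialDMat hgG j] with y h1 h2
    rw [h1, h2]
  have hneg : ∀ β : Form n r (p + 1), formInner (g x) (-β) α = -formInner (g x) β α := by
    intro β
    have : ∀ I, coeff (-β) I = -coeff β I := fun I => rfl
    simp [formInner_eq_sum, this]
  rw [curvatureOp, LinearMap.neg_apply, hneg, formInner_wedgeContractOp _ hsymm, mul_neg,
    mul_inv_cancel_left₀ (by positivity), ← Finset.sum_neg_distrib]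
  refine Finset.sum_congr rfl fun J _ => ?_
  simp only [bochnerIntegrand, hd, hA, ← Finset.sum_neg_distrib]
  refine Finset.sum_congr rfl fun i _ => Finset.sum_congr rfl fun j _ => ?_
  rw [contractField, contractField, hf.eq_of_nhds, ← dotProduct_neg, ← neg_mulVec, neg_sub]
  simp

/-- A metric near a point extends to a metric on the whole space, which is Euclidean outside a
compact set. -/
lemma IsC2Metric.exists_extension {D : Set (Rn n)} {g : Rn n → Matrix (Fin r) (Fin r) ℝ}
    (hg : IsC2Metric D g) (hD : IsOpen D) {x₀ : Rn n} (hx₀ : x₀ ∈ D) :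
    ∃ G : Rn n → Matrix (Fin r) (Fin r) ℝ, (∀ τ ξ, ContDiff ℝ 2 fun y => G y τ ξ) ∧
      (∀ x, (G x).PosDef) ∧ ∃ U ∈ 𝓝 x₀, ∀ x ∈ U, G x = g x := by
  obtain ⟨ε, hε, hball⟩ := Metric.isOpen_iff.1 hD x₀ hx₀
  let χ : ContDiffBump x₀ := ⟨ε / 4, ε / 2, by positivity, by linarith⟩
  have hχD : tsupport χ ⊆ D := by
    rw [χ.tsupport_eq]
    exact (closedBall_subset_ball (by change ε / 2 < ε; linarith)).trans hball
  refine ⟨fun x => χ x • g x + (1 - χ x) • 1, fun τ ξ => ?_, fun x => ?_,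
    closedBall x₀ χ.rIn, closedBall_mem_nhds _ χ.rIn_pos, fun x hx => ?_⟩
  · have hχ : ContDiff ℝ 2 χ := χ.contDiff
    have h1 : ContDiff ℝ 2 fun x => χ x * g x τ ξ := by
      rw [contDiff_iff_contDiffAt]
      intro x
      by_cases hx : x ∈ tsupport χ
      · exact hχ.contDiffAt.mul ((hg.contDiffOn τ ξ).contDiffAt (hD.mem_nhds (hχD hx)))
      · have : (fun x => χ x * g x τ ξ) =ᶠ[𝓝 x] fun _ => 0 := by
          filter_upwards [(isClosed_tsupport χ).isOpen_compl.mem_nhds hx] with y hy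
          simp [image_eq_zero_of_notMem_tsupport hy]
        exact contDiffAt_const.congr_of_eventuallyEq this
    change ContDiff ℝ 2 fun x => χ x * g x τ ξ + (1 - χ x) * (1 : Matrix (Fin r) (Fin r) ℝ) τ ξ
    exact h1.add ((contDiff_const.sub hχ).mul contDiff_const)
  · by_cases hx : χ x = 0
    · simpa [hx] using PosDef.one
    · have hxD : x ∈ D := hχD (subset_tsupport _ hx)
      refine ((hg.posDef x hxD).smul (lt_of_le_of_ne χ.nonneg (Ne.symm hx))).add_posSemidef ?_
      exact PosSemidef.one.smul (sub_nonneg.2 χ.le_one)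
  · simp [χ.one_of_mem_closedBall hx]

/-- Every constant form is near a given point the restriction of a closed form with small compact
support. -/
lemma exists_closed_form (α : Form n r (p + 1)) {x₀ : Rn n} {V : Set (Rn n)} (hV : V ∈ 𝓝 x₀) :
    ∃ f : Rn n → Form n r (p + 1), IsCompactlySupportedForm V f ∧ (∀ x, extDeriv f x = 0) ∧
      f =ᶠ[𝓝 x₀] fun _ => α := by
  obtain ⟨ε, hε, hball⟩ := Metric.mem_nhds_iff.1 hV
  let χ : ContDiffBump x₀ := ⟨ε / 4, ε / 2, by positivity, by linarith⟩
  -- `d` of the linear form `x ↦ x ⌟ α` is `(p + 1) α`.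
  let ℓ : Rn n →L[ℝ] Form n r p := ((p : ℝ) + 1)⁻¹ • α.curryLeft
  let η : Rn n → Form n r p := fun x => χ x • ℓ (x - x₀)
  have hη : ContDiff ℝ ∞ η :=
    χ.contDiff.smul (ℓ.contDiff.comp (contDiff_id.sub contDiff_const))
  have hηs : tsupport η ⊆ closedBall x₀ (ε / 2) := by
    have h : tsupport χ = closedBall x₀ (ε / 2) := χ.tsupport_eq
    rw [← h]
    have hsub : Function.support η ⊆ Function.support χ :=
      fun x hx h0 => hx (by simp [η, h0])
    exact closure_mono hsub
  have hfs : tsupport (extDeriv η) ⊆ closedBall x₀ (ε / 2) := by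
    refine (closure_minimal ?_ (isClosed_tsupport η)).trans hηs
    intro x hx
    by_contra hxs
    refine hx ?_
    have : fderiv ℝ η x = 0 := image_eq_zero_of_notMem_tsupport fun h =>
      hxs (tsupport_fderiv_subset ℝ h)
    rw [extDeriv, this]
    exact map_zero (ContinuousAlternatingMap.alternatizeUncurryFinCLM ℝ (Rn n) (Fin r → ℝ))
  refine ⟨extDeriv η, ⟨?_, ?_, ?_⟩, fun x => ?_, ?_⟩
  · exact (ContinuousAlternatingMap.alternatizeUncurryFinCLM ℝ (Rn n) (Fin r → ℝ)).contDiff.comp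
      (hη.fderiv_right (m := ∞) le_rfl)
  · exact HasCompactSupport.of_support_subset_isCompact (isCompact_closedBall x₀ (ε / 2))
      ((subset_tsupport _).trans hfs)
  · exact hfs.trans ((closedBall_subset_ball (by linarith)).trans hball)
  · rw [extDeriv_extDeriv hη (by simpa using two_le_infty)]
    rfl
  · have h1 : η =ᶠ[𝓝 x₀] fun x => ℓ (x - x₀) :=
      χ.eventuallyEq_one.mono fun x hx => by simp [η, hx]
    refine h1.eventuallyEq_nhds.mono fun x hx => ?_
    have h2 : fderiv ℝ (fun x => ℓ (x - x₀)) x = ℓ := by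
      rw [fderiv_comp_sub (f := fun y => ℓ y)]
      exact ℓ.fderiv
    rw [hx.extDeriv_eq, extDeriv, h2]
    simp only [ℓ]
    rw [ContinuousAlternatingMap.alternatizeUncurryFin_smul,
      ContinuousAlternatingMap.alternatizeUncurryFin_curryLeft, ← Nat.cast_smul_eq_nsmul ℝ,
      smul_smul]
    push_cast
    rw [inv_mul_cancel₀ (by positivity), one_smul]

/-- Gaussian weights concentrate at their centre, so the sign of the weighted integrals of a
function passes to its value there. -/
lemma nonneg_of_integral_gaussian_nonneg {F : Rn n → ℝ} (hF : Continuous F)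
    (hc : HasCompactSupport F) (x₀ : Rn n)
    (h : ∀ k : ℕ, 0 < k → 0 ≤ ∫ x, Real.exp (-(k * ‖x - x₀‖ ^ 2)) * F x) : 0 ≤ F x₀ := by
  obtain ⟨R, hR, hsub⟩ := hc.isCompact.isBounded.subset_closedBall_lt 0 x₀
  have hmem : x₀ ∈ closure (interior (closedBall x₀ R)) :=
    subset_closure (mem_interior_iff_mem_nhds.2 (closedBall_mem_nhds x₀ hR))
  have hcont : Continuous fun x : Rn n => Real.exp (-‖x - x₀‖ ^ 2) := by fun_prop
  have ht := tendsto_setIntegral_pow_smul_of_unique_maximum_of_isCompact_of_continuousOn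
    (μ := (volume : Measure (Rn n))) (g := F) (isCompact_closedBall x₀ R)
    hcont.continuousOn (fun y _ hy => by
      have : 0 < ‖y - x₀‖ := norm_pos_iff.2 (sub_ne_zero.2 hy)
      rw [Real.exp_lt_exp]
      simp
      positivity) (fun x _ => (Real.exp_pos _).le) (Real.exp_pos _) hmem hF.continuousOn
  refine ge_of_tendsto ht ((eventually_gt_atTop 0).mono fun k hk => ?_)
  refine smul_nonneg (inv_nonneg.2 (integral_nonneg fun x => by positivity)) ?_
  rw [setIntegral_eq_integral_of_forall_compl_eq_zero]
  · refine (h k hk).trans_eq (integral_congr_ae (Eventually.of_forall fun x => ?_))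
    simp only [← Real.exp_nat_mul, smul_eq_mul]
    congr 2
    ring
  · intro x hx
    simp [image_eq_zero_of_notMem_tsupport fun h => hx (hsub h)]

lemma contDiff_quadraticWeight (a b : ℝ) (x₀ : Rn n) :
    ContDiff ℝ ∞ fun x : Rn n => a * ‖x - x₀‖ ^ 2 - b :=
  (contDiff_const.mul ((contDiff_id.sub contDiff_const).norm_sq ℝ)).sub contDiff_const

lemma hessMatrix_quadraticWeight (a b : ℝ) (x₀ x : Rn n) :
    hessMatrix (fun x : Rn n => a * ‖x - x₀‖ ^ 2 - b) x = (2 * a) • 1 := by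
  have h1 : ∀ j, partialD j (fun x : Rn n => a * ‖x - x₀‖ ^ 2 - b) =
      fun y => 2 * a * (coframe j y - coframe j x₀) := by
    intro j
    ext y
    have h := ((((hasFDerivAt_id y).sub_const x₀).norm_sq).const_mul a).sub_const b
    rw [partialD]
    erw [h.fderiv]
    simp [frame, coframe, EuclideanSpace.inner_single_right]
    ring
  ext i j
  simp only [hessMatrix, of_apply, h1]
  have h := ((((coframe j : Rn n →L[ℝ] ℝ).hasFDerivAt (x := x)).sub_const
    (coframe j x₀)).const_mul (2 * a)).fderiv
  rw [partialD, h]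
  simp [coframe_frame, one_apply, eq_comm]

lemma isStrictlyConvexWeight_quadraticWeight {a : ℝ} (ha : 0 < a) (b : ℝ) (x₀ : Rn n) :
    IsStrictlyConvexWeight fun x : Rn n => a * ‖x - x₀‖ ^ 2 - b where
  contDiff := contDiff_quadraticWeight a b x₀
  hess_posDef x := by
    rw [hessMatrix_quadraticWeight]
    exact PosDef.one.smul (by positivity)

/-- Nakano semipositivity from the `L²` existence property for quadratic weights. -/
lemma nakanoSemipositive_of_quadraticWeights {D : Set (Rn n)} (hD : IsOpen D)
    {g : Rn n → Matrix (Fin r) (Fin r) ℝ} (hg : IsC2Metric D g)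
    (h : ∀ (a b : ℝ) (x₀ : Rn n), 0 < a → 0 < b →
      L2Solvable p D g (fun x => a * ‖x - x₀‖ ^ 2 - b)) :
    NakanoSemipositive p D g := by
  intro x₀ hx₀ α
  obtain ⟨G, hG, hGpos, U, hU, hGg⟩ := hg.exists_extension hD hx₀
  obtain ⟨f, hf, hfd, hfα⟩ := exists_closed_form α (inter_mem hU (hD.mem_nhds hx₀))
  have hfD : IsCompactlySupportedForm D f :=
    ⟨hf.contDiff, hf.hasCompactSupport, hf.tsupport_subset.trans Set.inter_subset_right⟩
  have hfU : tsupport f ⊆ U := hf.tsupport_subset.trans Set.inter_subset_left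
  have hf2 : ContDiff ℝ 2 f := hf.contDiff.of_le two_le_infty
  have hcont : Continuous fun x => ∑ J, bochnerIntegrand G (contractField f J) x :=
    continuous_finsetSum _ fun J _ =>
      continuous_bochnerIntegrand hG (fun i τ => contDiff_coeff hf2 _ τ) hGpos
  have hcs : HasCompactSupport fun x => ∑ J, bochnerIntegrand G (contractField f J) x := by
    refine HasCompactSupport.intro hf.hasCompactSupport fun x hx => ?_
    exact Finset.sum_eq_zero fun J _ => bochnerIntegrand_eq_zero fun i h =>
      hx (tsupport_contractField_subset f J i h)
  have h0 := nonneg_of_integral_gaussian_nonneg hcont hcs x₀ fun k hk => by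
    have hk' : (0 : ℝ) < k := Nat.cast_pos.2 hk
    have h1 := integral_bochnerIntegrand_nonneg hD hg.posDef hG hGpos hfD (fun x _ => hfd x) hfU
      hGg (contDiff_quadraticWeight (k : ℝ) 1 x₀) (by positivity)
      (hessMatrix_quadraticWeight (k : ℝ) 1 x₀) (h k 1 x₀ hk' one_pos)
    have e : ∀ x : Rn n, Real.exp (-(k * ‖x - x₀‖ ^ 2 - 1)) =
        Real.exp 1 * Real.exp (-(k * ‖x - x₀‖ ^ 2)) := by
      intro x
      rw [← Real.exp_add]
      congr 1
      ring
    simp_rw [e, mul_assoc] at h1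
    rw [integral_const_mul] at h1
    exact nonneg_of_mul_nonneg_right h1 (Real.exp_pos 1)
  rw [sum_bochnerIntegrand_eq_formInner hG hGpos
    ((eventually_of_mem hU hGg).mono fun x hx => hx.symm) hfα] at h0
  exact nonneg_of_mul_nonneg_right h0 (by positivity)

end FlatBundle

theorem theorem1p1 (n r p : ℕ) (hpn : p + 1 ≤ n) (D : Set (FlatBundle.Rn n))
    (hDopen : IsOpen D) (hDconn : IsConnected D)
    (g : FlatBundle.Rn n → Matrix (Fin r) (Fin r) ℝ) (hg : FlatBundle.IsC2Metric D g) :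
    ((∀ ψ : FlatBundle.Rn n → ℝ, FlatBundle.IsStrictlyConvexWeight ψ →
        FlatBundle.L2Solvable p D g ψ) →
      FlatBundle.NakanoSemipositive p D g) ∧
    ((∀ (a b : ℝ) (x₀ : FlatBundle.Rn n), 0 < a → 0 < b →
        FlatBundle.L2Solvable p D g (fun x => a * ‖x - x₀‖ ^ 2 - b)) →
      FlatBundle.NakanoSemipositive p D g) :=
  ⟨fun h => FlatBundle.nakanoSemipositive_of_quadraticWeights hDopen hg fun _ b x₀ ha _ =>
      h _ (FlatBundle.isStrictlyConvexWeight_quadraticWeight ha b x₀),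
    fun h => FlatBundle.nakanoSemipositive_of_quadraticWeights hDopen hg h⟩
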